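/- A Steiner forest of a finite simple graph $G$ with respect to a set $S=\{(s_1,t_1),\dots,(s_p,t_p)\}$ of pairs of vertices of $G$ (terminal pairs) is a subgraph $F$ of $G$ such that, for every $i\in\{1,\dots,p\}$, the vertices $s_i$ and $t_i$ belong to the same connected component of $F$. The problem Steiner Forest has as input a finite simple graph $G$, a set $S$ of terminal pairs and an integer $k\ge 0$, and asks whether $(G,S)$ has a Steiner forest $F$ with $|E(F)|\le k$. Let $2K_{1,3}$ denote the disjoint union of two copies of the claw $K_{1,3}$ (the star with three leaves); a graph $G$ is $2K_{1,3}$-subgraph-free if it has no subgraph, induced or not, that is isomorphic to $2K_{1,3}$. Steiner Forest, restricted to inputs $(G,S,k)$ in which $G$ is $2K_{1,3}$-subgraph-free, is polynomial-time solvable: there is an algorithm that decides every such input correctly, in a number of steps that is bounded by a polynomial in the size of (the encoding of) the input, with $G$ given by its adjacency matrix, $S$ by a list of pairs, and $k$ in binary. -/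

import Mathlib

/-! ## A machine model with a step count: the textbook WHILE language over binary trees -/

namespace WhileLang

/-- The data of the WHILE language: finite binary trees. -/
inductive Val : Type
  | nil : Val
  | cons : Val → Val → Val

namespace Val

/-- The size of a tree: its number of nodes, leaves included. -/
def size : Val → ℕ
  | nil => 1
  | cons a b => a.size + b.size + 1

/-- The head of a tree (`nil` for the empty tree). -/
def hd : Val → Val
  | nil => nil
  | cons a _ => a

/-- The tail of a tree (`nil` for the empty tree). -/
def tl : Val → Val
  | nil => nil
  | cons _ b => b

/-- A list of trees as a tree. -/
def ofList : List Val → Val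
  | [] => nil
  | a :: l => cons a (ofList l)

/-- A Boolean as a tree; `false` is `nil`. -/
def ofBool : Bool → Val
  | false => nil
  | true => cons nil nil

/-- A natural number in unary. -/
def ofNatUnary (n : ℕ) : Val := ofList (List.replicate n nil)

/-- A natural number in binary, least significant bit first. -/
def ofNatBinary (n : ℕ) : Val := ofList (n.bits.map ofBool)

end Val

/-- A store assigns a tree to every program variable. Variables are named by numbers; a program
mentions only finitely many of them. -/
abbrev Store := ℕ → Val

/-- Expressions. -/
inductive Expr : Type
  | var : ℕ → Expr
  | nil : Expr
  | cons : Expr → Expr → Expr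
  | hd : Expr → Expr
  | tl : Expr → Expr

namespace Expr

/-- The value of an expression in a store. -/
def eval (s : Store) : Expr → Val
  | var x => s x
  | nil => Val.nil
  | cons e f => Val.cons (e.eval s) (f.eval s)
  | hd e => (e.eval s).hd
  | tl e => (e.eval s).tl

/-- The number of elementary steps (reading a variable, creating a constant, allocating one cell,
following one pointer) in the evaluation of an expression. -/
def cost : Expr → ℕ
  | var _ => 1
  | nil => 1
  | cons e f => e.cost + f.cost + 1
  | hd e => e.cost + 1
  | tl e => e.cost + 1

end Expr

/-- Programs: assignment, sequencing, branching and iteration. A test is an expression, which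
counts as true if its value is not `nil`. -/
inductive Cmd : Type
  | assign : ℕ → Expr → Cmd
  | seq : Cmd → Cmd → Cmd
  | cond : Expr → Cmd → Cmd → Cmd
  | loop : Expr → Cmd → Cmd

/-- `Run c s s' t`: the program `c`, started in the store `s`, halts in the store `s'` after
exactly `t` elementary steps. Each step allocates at most one cell (trees are shared, not copied)
and only the root of a tree can be inspected, so that this is a pointer machine, polynomially
equivalent to Turing machines. -/
inductive Run : Cmd → Store → Store → ℕ → Prop
  | assign (x : ℕ) (e : Expr) (s : Store) :
      Run (Cmd.assign x e) s (Function.update s x (e.eval s)) (e.cost + 1)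
  | seq {c d : Cmd} {s s' s'' : Store} {t u : ℕ} (hc : Run c s s' t) (hd : Run d s' s'' u) :
      Run (Cmd.seq c d) s s'' (t + u)
  | cond_true {e : Expr} {c d : Cmd} {s s' : Store} {t : ℕ} (he : e.eval s ≠ Val.nil)
      (hc : Run c s s' t) : Run (Cmd.cond e c d) s s' (e.cost + 1 + t)
  | cond_false {e : Expr} {c d : Cmd} {s s' : Store} {t : ℕ} (he : e.eval s = Val.nil)
      (hd : Run d s s' t) : Run (Cmd.cond e c d) s s' (e.cost + 1 + t)
  | loop_true {e : Expr} {c : Cmd} {s s' s'' : Store} {t u : ℕ} (he : e.eval s ≠ Val.nil)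
      (hc : Run c s s' t) (hl : Run (Cmd.loop e c) s' s'' u) :
      Run (Cmd.loop e c) s s'' (e.cost + 1 + t + u)
  | loop_false {e : Expr} {c : Cmd} {s : Store} (he : e.eval s = Val.nil) :
      Run (Cmd.loop e c) s s (e.cost + 1)

/-- The initial store: the input in variable `0`, all other variables `nil`. -/
def initStore (v : Val) : Store := fun x => if x = 0 then v else Val.nil

/-- The decision problem with yes-instances `yes` is polynomial-time solvable on the instances in
`dom`, with respect to the encoding `enc`: one fixed program halts on every such instance within a
number of steps that is polynomial in the size of the encoding, and answers correctly (the answer is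
in variable `0`, where `nil` means no). -/
def PolyTimeSolvableOn {α : Type} (enc : α → Val) (dom yes : α → Prop) : Prop :=
  ∃ (c : Cmd) (p : Polynomial ℕ), ∀ a : α, dom a →
    ∃ (s : Store) (t : ℕ), Run c (initStore (enc a)) s t ∧ t ≤ p.eval (enc a).size ∧
      (s 0 ≠ Val.nil ↔ yes a)

end WhileLang

/-! ## Steiner forests -/

/-- `F` is a Steiner forest of `(G, S)`: a subgraph of `G` such that both terminals of each pair lie
in the same connected component of `F`. -/
def IsSteinerForest {V : Type} (G : SimpleGraph V) (S : List (V × V)) (F : G.Subgraph) : Prop :=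
  ∀ p ∈ S, ∃ (hs : p.1 ∈ F.verts) (ht : p.2 ∈ F.verts),
    F.coe.Reachable ⟨p.1, hs⟩ ⟨p.2, ht⟩

/-- An instance of Steiner Forest: a finite graph, a list of terminal pairs, an edge budget. -/
structure SteinerInstance : Type where
  /-- the number of vertices -/
  n : ℕ
  /-- the graph -/
  graph : SimpleGraph (Fin n)
  /-- the terminal pairs -/
  pairs : List (Fin n × Fin n)
  /-- the edge budget -/
  k : ℕ

namespace SteinerInstance

/-- The question: is there a Steiner forest with at most `k` edges? -/
def IsYes (I : SteinerInstance) : Prop :=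
  ∃ F : I.graph.Subgraph, IsSteinerForest I.graph I.pairs F ∧ F.edgeSet.ncard ≤ I.k

open Classical in
/-- The rows of the adjacency matrix of the graph. -/
noncomputable def adjMatrixRows (I : SteinerInstance) : List (List Bool) :=
  List.ofFn fun i : Fin I.n => List.ofFn fun j : Fin I.n => decide (I.graph.Adj i j)

/-- The encoding of an instance: the adjacency matrix, the list of terminal pairs (a vertex is
written as its index in unary), and the edge budget in binary. -/
noncomputable def encode (I : SteinerInstance) : WhileLang.Val :=
  WhileLang.Val.ofList
    [WhileLang.Val.ofList (I.adjMatrixRows.map fun r =>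
        WhileLang.Val.ofList (r.map WhileLang.Val.ofBool)),
      WhileLang.Val.ofList (I.pairs.map fun p =>
        WhileLang.Val.cons (WhileLang.Val.ofNatUnary p.1) (WhileLang.Val.ofNatUnary p.2)),
      WhileLang.Val.ofNatBinary I.k]

end SteinerInstance

/-- The claw `K_{1,3}`. -/
abbrev claw : SimpleGraph (Fin 1 ⊕ Fin 3) := completeBipartiteGraph (Fin 1) (Fin 3)

/-- `2K_{1,3}`, the disjoint union of two claws. -/
abbrev twoClaws : SimpleGraph ((Fin 1 ⊕ Fin 3) ⊕ (Fin 1 ⊕ Fin 3)) := SimpleGraph.sum claw claw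

/-! Let `F` be an acyclic solution, and suppose that a vertex `c` and a set `R` of boundedly many
edges outside `F` are known such that `G - c - R` has maximum degree at most two. The components of
`G - c - R` are then paths and cycles, and `F - c` cuts them into disjoint subpaths. Such a subpath
is either joined to `c` by an edge of `F`, or it is a whole component of `F` and hence closed under
the terminal pairs. It therefore suffices to partition a spanning path of each component into
segments, where a segment with `m` vertices costs `m - 1` if it is closed, `m` if it is not closed
but contains a neighbour of `c`, and is forbidden otherwise. A dynamic program over suffixes finds
the best partition. A cycle has to be cut at an edge outside `F`; all ways to do so are tried.

Why `c` and `R` exist (`exists_thin`): in a `2K_{1,3}`-subgraph-free graph any two claws meet. If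
some vertex has degree at least 7, every claw contains it (`thin_of_large_degree`), and nothing else
need be deleted. Otherwise all degrees are at most 6, and every vertex of degree at least three lies
in a fixed claw or next to it, so there are at most 4 + 4 · 6 = 28 of them (`card_branch_le`). The
claws of the forest `F` are pairwise meeting subtrees and share a vertex `c` by the Helly property
(`exists_common_vertex`). For `R` take the at most 28 · 6 = 168 edges outside `F` at vertices of
degree at least three: a vertex that keeps three neighbours in `G - c - R` would be the centre of a
claw of `F` avoiding `c`.

The procedure `solve` tries all `c` and `R`. A finite value is realised by an actual solution for
every guess (`exists_forest_of_total_le`), and the right guess yields a value of at most `|E(F)|`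
(`total_le`). The running time is handled by a class `PF` of polynomial-time functions, closed under
composition, branching and folds with bounded intermediate values, in which `solve` can be
assembled. -/

namespace WhileLang

/-! ### Representation of data by trees, and sizes -/

/-- Types whose elements are represented as trees. -/
class Enc (α : Type) where
  /-- the representation -/
  enc : α → Val

open Enc

/-- Many representations coincide as trees, which makes conversions free: a pair `(a, l)` is the
list `a :: l`, a unary number is a list of units, and a tuple ending in `()` is a list of its other
components. -/
instance : Enc Unit := ⟨fun _ => Val.nil⟩
instance : Enc Bool := ⟨Val.ofBool⟩
instance : Enc ℕ := ⟨Val.ofNatUnary⟩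
instance {α β : Type} [Enc α] [Enc β] : Enc (α × β) := ⟨fun p => Val.cons (enc p.1) (enc p.2)⟩
instance {α : Type} [Enc α] : Enc (List α) := ⟨fun l => Val.ofList (l.map enc)⟩

/-- The size of the representation. -/
def sz {α : Type} [Enc α] (a : α) : ℕ := (enc a).size

section Size

variable {α β : Type} [Enc α] [Enc β]

theorem sz_pair (a : α) (b : β) : sz (a, b) = sz a + sz b + 1 := rfl

@[simp] theorem sz_nil : sz ([] : List α) = 1 := rfl

@[simp] theorem sz_cons (a : α) (l : List α) : sz (a :: l) = sz a + sz l + 1 := rfl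

@[simp] theorem sz_unit (a : Unit) : sz a = 1 := rfl

theorem sz_bool_le (b : Bool) : sz b ≤ 3 := by cases b <;> decide

@[simp] theorem sz_nat (n : ℕ) : sz n = 2 * n + 1 := by
  induction n with
  | zero => rfl
  | succ n ih =>
    have : sz (n + 1) = 1 + sz n + 1 := rfl
    omega

theorem sz_append (l m : List α) : sz (l ++ m) + 1 = sz l + sz m := by
  induction l with
  | nil => simp; omega
  | cons a l ih => simp; omega

@[simp] theorem sz_reverse (l : List α) : sz l.reverse = sz l := by
  induction l with
  | nil => rfl
  | cons a l ih =>
    have := sz_append l.reverse [a]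
    simp at this ⊢
    omega

theorem length_le_sz (l : List α) : l.length ≤ sz l := by
  induction l with
  | nil => simp
  | cons a l ih => simp; omega

theorem sz_le_of_mem {a : α} {l : List α} (h : a ∈ l) : sz a ≤ sz l := by
  induction l with
  | nil => simp at h
  | cons b l ih =>
    rcases List.mem_cons.1 h with rfl | h
    · simp; omega
    · have := ih h
      simp; omega

theorem sz_list_le {l : List α} {B : ℕ} (h : ∀ a ∈ l, sz a ≤ B) :
    sz l ≤ l.length * (B + 1) + 1 := by
  induction l with
  | nil => simp
  | cons a l ih =>
    have h1 := h a (by simp)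
    have h2 := ih fun b hb => h b (by simp [hb])
    simp only [sz_cons, List.length_cons]
    nlinarith

theorem sz_sublist {l m : List α} (h : l.Sublist m) : sz l ≤ sz m := by
  induction h with
  | slnil => simp
  | cons a h ih => simp; omega
  | cons_cons a h ih => simp; omega

end Size

/-! ### Polynomial bounds and polynomial-time functions -/

/-- A function bounded by a polynomial in the size of its argument. -/
def PolyBdd {α : Type} [Enc α] (T : α → ℕ) : Prop :=
  ∃ p : Polynomial ℕ, ∀ a, T a ≤ p.eval (sz a)

theorem poly_mono (p : Polynomial ℕ) {m n : ℕ} (h : m ≤ n) : p.eval m ≤ p.eval n := by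
  rw [Polynomial.eval_eq_sum, Polynomial.eval_eq_sum]
  exact Finset.sum_le_sum fun i _ => Nat.mul_le_mul_left _ (Nat.pow_le_pow_left h i)

namespace PolyBdd

variable {α β : Type} [Enc α] [Enc β] {T U : α → ℕ}

theorem of_le (h : PolyBdd U) (hle : ∀ a, T a ≤ U a) : PolyBdd T := by
  obtain ⟨p, hp⟩ := h
  exact ⟨p, fun a => (hle a).trans (hp a)⟩

theorem const (n : ℕ) : PolyBdd fun _ : α => n := ⟨Polynomial.C n, fun a => by simp⟩

theorem size : PolyBdd fun a : α => sz a := ⟨Polynomial.X, fun a => by simp⟩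

theorem add (h : PolyBdd T) (h' : PolyBdd U) : PolyBdd fun a => T a + U a := by
  obtain ⟨p, hp⟩ := h
  obtain ⟨q, hq⟩ := h'
  exact ⟨p + q, fun a => by simpa using Nat.add_le_add (hp a) (hq a)⟩

theorem mul (h : PolyBdd T) (h' : PolyBdd U) : PolyBdd fun a => T a * U a := by
  obtain ⟨p, hp⟩ := h
  obtain ⟨q, hq⟩ := h'
  exact ⟨p * q, fun a => by simpa using Nat.mul_le_mul (hp a) (hq a)⟩

/-- A polynomially bounded quantity of a polynomially bounded argument. -/
theorem polyComp (h : PolyBdd T) (p : Polynomial ℕ) : PolyBdd fun a => p.eval (T a) := by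
  obtain ⟨q, hq⟩ := h
  exact ⟨p.comp q, fun a => by simpa [Polynomial.eval_comp] using poly_mono p (hq a)⟩

theorem comp {V : β → ℕ} {f : α → β} (h : PolyBdd V) (hf : PolyBdd fun a => sz (f a)) :
    PolyBdd fun a => V (f a) := by
  obtain ⟨p, hp⟩ := h
  exact (hf.polyComp p).of_le fun a => hp _

end PolyBdd

/-- `Computes c f T`: for every base register `b`, the program `c b` replaces an argument of `f` in
register `b` by the value of `f`, in at most `T` steps, without changing the registers below
`b`. -/
def Computes {α β : Type} [Enc α] [Enc β] (c : ℕ → Cmd) (f : α → β) (T : α → ℕ) : Prop :=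
  ∀ (b : ℕ) (s : Store) (a : α), s b = enc a →
    ∃ (s' : Store) (t : ℕ), Run (c b) s s' t ∧ s' b = enc (f a) ∧ (∀ x < b, s' x = s x) ∧ t ≤ T a

/-- Polynomial-time computable functions. -/
def PF {α β : Type} [Enc α] [Enc β] (f : α → β) : Prop :=
  (∃ (c : ℕ → Cmd) (T : α → ℕ), PolyBdd T ∧ Computes c f T) ∧ PolyBdd fun a => sz (f a)

/-- Assignments run in the cost of their expression. -/
theorem Run.assign' {x : ℕ} {e : Expr} {s : Store} {v : Val} (h : e.eval s = v) :
    Run (Cmd.assign x e) s (Function.update s x v) (e.cost + 1) := h ▸ Run.assign x e s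

/-! ### Closure properties of polynomial-time functions -/

namespace PF

variable {α β γ δ : Type} [Enc α] [Enc β] [Enc γ] [Enc δ]

theorem congr {f g : α → β} (h : PF f) (e : ∀ a, f a = g a) : PF g := (funext e : f = g) ▸ h

theorem size {f : α → β} (h : PF f) : PolyBdd fun a => sz (f a) := h.2

theorem of_expr {f : α → β} (e : ℕ → Expr) (n : ℕ) (hn : ∀ b, (e b).cost ≤ n)
    (he : ∀ (b : ℕ) (s : Store) (a : α), s b = enc a → (e b).eval s = enc (f a))
    (hs : PolyBdd fun a => sz (f a)) : PF f := by
  refine ⟨⟨fun b => Cmd.assign b (e b), fun _ => n + 1, .const _, fun b s a h => ?_⟩, hs⟩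
  refine ⟨_, _, Run.assign' (he b s a h), by simp, fun x hx => ?_, by simpa using hn b⟩
  exact Function.update_of_ne hx.ne _ _

/-- The time of the second stage is polynomial in the size of the intermediate value; this is why
`PF` also bounds the size of the output. -/
theorem comp {g : β → γ} {f : α → β} (hg : PF g) (hf : PF f) : PF fun a => g (f a) := by
  obtain ⟨⟨c, T, hT, hc⟩, hs⟩ := hf
  obtain ⟨⟨d, U, hU, hd⟩, hs'⟩ := hg
  refine ⟨⟨fun b => .seq (c b) (d b), fun a => T a + U (f a), hT.add (hU.comp hs), ?_⟩,
    hs'.comp hs⟩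
  intro b s a h
  obtain ⟨s1, t1, r1, e1, p1, l1⟩ := hc b s a h
  obtain ⟨s2, t2, r2, e2, p2, l2⟩ := hd b s1 _ e1
  exact ⟨s2, _, r1.seq r2, e2, fun x hx => (p2 x hx).trans (p1 x hx), Nat.add_le_add l1 l2⟩

theorem pair {f : α → β} {g : α → γ} (hf : PF f) (hg : PF g) : PF fun a => (f a, g a) := by
  obtain ⟨⟨c, T, hT, hc⟩, hs⟩ := hf
  obtain ⟨⟨d, U, hU, hd⟩, hs'⟩ := hg
  -- The argument stays in register `b` while copies of it are processed at bases `b + 1` and `b +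
  -- 2`. The second run uses a higher base, so it preserves the result of the first.
  refine ⟨⟨fun b => .seq (.assign (b + 1) (.var b)) (.seq (c (b + 1))
    (.seq (.assign (b + 2) (.var b)) (.seq (d (b + 2))
      (.assign b (.cons (.var (b + 1)) (.var (b + 2))))))),
    fun a => T a + U a + 8, (hT.add hU).add (.const _), ?_⟩,
    ((hs.add hs').add (.const 1)).of_le fun a => (sz_pair _ _).le⟩
  intro b s a h
  have r0 := Run.assign (b + 1) (.var b) s
  obtain ⟨s1, t1, r1, e1, p1, l1⟩ := hc (b + 1) (Function.update s (b + 1) (s b)) a (by simpa)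
  have r2 := Run.assign (b + 2) (.var b) s1
  have hb : s1 b = enc a := by rw [p1 b (by omega), Function.update_of_ne (by omega), h]
  obtain ⟨s3, t3, r3, e3, p3, l3⟩ := hd (b + 2) (Function.update s1 (b + 2) (s1 b)) a (by simpa)
  have hb1 : s3 (b + 1) = enc (f a) := by
    rw [p3 _ (by omega), Function.update_of_ne (by omega), e1]
  refine ⟨_, _, r0.seq (r1.seq (r2.seq (r3.seq (Run.assign' (v := enc (f a, g a)) ?_)))),
    by simp, fun x hx => ?_, ?_⟩
  · simp only [Expr.eval, e3, hb1]; rfl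
  · rw [Function.update_of_ne (by omega), p3 _ (by omega), Function.update_of_ne (by omega),
      p1 _ (by omega), Function.update_of_ne (by omega)]
  · simp only [Expr.cost]; omega

theorem fst' : PF fun p : α × β => p.1 :=
  of_expr (fun b => .hd (.var b)) 2 (fun _ => le_rfl) (fun _ _ _ h => by simp only [Expr.eval, h]; rfl)
    (PolyBdd.size.of_le fun p => by
      have : sz p = sz p.1 + sz p.2 + 1 := rfl
      omega)

theorem snd' : PF fun p : α × β => p.2 :=
  of_expr (fun b => .tl (.var b)) 2 (fun _ => le_rfl) (fun _ _ _ h => by simp only [Expr.eval, h]; rfl)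
    (PolyBdd.size.of_le fun p => by
      have : sz p = sz p.1 + sz p.2 + 1 := rfl
      omega)

theorem fst {f : α → β × γ} (h : PF f) : PF fun a => (f a).1 := fst'.comp h

theorem snd {f : α → β × γ} (h : PF f) : PF fun a => (f a).2 := snd'.comp h

theorem comp₂ {g : β × γ → δ} {f : α → β} {f' : α → γ} (hg : PF g) (hf : PF f) (hf' : PF f') :
    PF fun a => g (f a, f' a) := hg.comp (hf.pair hf')

theorem cons {f : α → β} {g : α → List β} (hf : PF f) (hg : PF g) : PF fun a => f a :: g a :=
  comp (g := fun p : β × List β => p.1 :: p.2)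
    (of_expr (fun b => .var b) 1 (fun _ => le_rfl) (fun _ _ _ h => h) PolyBdd.size) (hf.pair hg)

theorem nil : PF fun _ : α => ([] : List β) :=
  of_expr (fun _ => .nil) 1 (fun _ => le_rfl) (fun _ _ _ _ => rfl) (.const 1)

theorem false : PF fun _ : α => false :=
  of_expr (fun _ => .nil) 1 (fun _ => le_rfl) (fun _ _ _ _ => rfl) (.const 1)

theorem true : PF fun _ : α => true :=
  of_expr (fun _ => .cons .nil .nil) 3 (fun _ => le_rfl) (fun _ _ _ _ => rfl) (.const 3)

theorem zero : PF fun _ : α => 0 :=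
  of_expr (fun _ => .nil) 1 (fun _ => le_rfl) (fun _ _ _ _ => rfl) (.const 1)

theorem succ {f : α → ℕ} (hf : PF f) : PF fun a => f a + 1 :=
  comp (g := fun n : ℕ => n + 1)
    (of_expr (fun b => .cons .nil (.var b)) 3 (fun _ => le_rfl)
      (fun _ _ _ h => by simp only [Expr.eval, h]; rfl)
      ((PolyBdd.size.add (.const 2)).of_le fun a => by simp; omega)) hf

theorem natConst (n : ℕ) : PF fun _ : α => n := by
  induction n with
  | zero => exact zero
  | succ n ih => exact ih.succ

theorem pred {f : α → ℕ} (hf : PF f) : PF fun a => f a - 1 :=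
  comp (g := fun n : ℕ => n - 1)
    (of_expr (fun b => .tl (.var b)) 2 (fun _ => le_rfl)
      (fun _ _ a h => by simp only [Expr.eval, h]; cases a <;> rfl)
      (PolyBdd.size.of_le fun a => by simp)) hf

theorem tail {f : α → List β} (hf : PF f) : PF fun a => (f a).tail :=
  comp (g := fun l : List β => l.tail)
    (of_expr (fun b => .tl (.var b)) 2 (fun _ => le_rfl)
      (fun _ _ a h => by simp only [Expr.eval, h]; cases a <;> rfl)
      (PolyBdd.size.of_le fun a => by cases a <;> simp; omega)) hf

/-- Branching on a test that is computed as a tree. -/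
theorem ite_aux {τ : Type} [Enc τ] {test : α → τ} {q : α → Bool} {f g : α → β} (ht : PF test)
    (hq : ∀ a, enc (test a) ≠ Val.nil ↔ q a = Bool.true) (hf : PF f) (hg : PF g) :
    PF fun a => if q a then f a else g a := by
  obtain ⟨⟨c, T, hT, hc⟩, hs⟩ := ht
  obtain ⟨⟨d, U, hU, hd⟩, hs'⟩ := hf
  obtain ⟨⟨e, W, hW, he⟩, hs''⟩ := hg
  refine ⟨⟨fun b => .seq (.assign (b + 1) (.var b)) (.seq (c (b + 1))
    (.cond (.var (b + 1)) (d b) (e b))),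
    fun a => T a + U a + W a + 8, ((hT.add hU).add hW).add (.const _), ?_⟩,
    (hs'.add hs'').of_le fun a => ?_⟩
  · intro b s a h
    have r0 := Run.assign (b + 1) (.var b) s
    obtain ⟨s1, t1, r1, e1, p1, l1⟩ := hc (b + 1) (Function.update s (b + 1) (s b)) a (by simpa)
    have hb : s1 b = enc a := by rw [p1 b (by omega), Function.update_of_ne (by omega), h]
    have hp : ∀ x < b, s1 x = s x := fun x hx => by
      rw [p1 _ (by omega), Function.update_of_ne (by omega)]
    by_cases hqa : q a = Bool.true
    · obtain ⟨s2, t2, r2, e2, p2, l2⟩ := hd b s1 a hb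
      refine ⟨s2, _, r0.seq (r1.seq (Run.cond_true ?_ r2)), by simpa [hqa] using e2,
        fun x hx => (p2 x hx).trans (hp x hx), ?_⟩
      · simpa only [Expr.eval, e1] using (hq a).2 hqa
      · simp only [Expr.cost]; omega
    · obtain ⟨s2, t2, r2, e2, p2, l2⟩ := he b s1 a hb
      refine ⟨s2, _, r0.seq (r1.seq (Run.cond_false ?_ r2)), by simpa [hqa] using e2,
        fun x hx => (p2 x hx).trans (hp x hx), ?_⟩
      · simp only [Expr.eval, e1]
        by_contra hne
        exact hqa ((hq a).1 hne)
      · simp only [Expr.cost]; omega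
  · dsimp only
    split_ifs <;> omega

theorem ite {q : α → Bool} {f g : α → β} (hq : PF q) (hf : PF f) (hg : PF g) :
    PF fun a => if q a then f a else g a :=
  ite_aux hq (fun a => by cases q a <;> simp [enc, Val.ofBool]) hf hg

theorem isZero {f : α → ℕ} (hf : PF f) : PF fun a => f a == 0 :=
  -- A unary number can itself serve as the test, being `nil` exactly when it is zero.
  (ite_aux (q := fun a => !(f a == 0)) hf
    (fun a => by cases f a <;> simp [enc, Val.ofNatUnary, Val.ofList, List.replicate_succ])
      false true).congr fun a => by
      cases f a <;> simp

/-- The loop of `foldl`: the argument is in register `b`, the remaining list in register `b + 1`,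
the current value in register `b + 2`. -/
theorem run_foldl_loop {σ : Type} [Enc σ] {step : α × β × σ → σ} {c : ℕ → Cmd}
    {T : α × β × σ → ℕ} (hc : Computes c step T) (b : ℕ) (a : α) (K : ℕ) (l : List β) :
    ∀ (st : σ) (s : Store), s b = enc a → s (b + 1) = enc l → s (b + 2) = enc st →
      (∀ l₁ x l₂, l = l₁ ++ x :: l₂ → T (a, x, l₁.foldl (fun s x => step (a, x, s)) st) ≤ K) →
      ∃ (s' : Store) (t : ℕ),
        Run (.loop (.var (b + 1)) (.seq
          (.assign (b + 3) (.cons (.var b) (.cons (.hd (.var (b + 1))) (.var (b + 2)))))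
          (.seq (c (b + 3)) (.seq (.assign (b + 2) (.var (b + 3)))
            (.assign (b + 1) (.tl (.var (b + 1)))))))) s s' t ∧
        s' (b + 2) = enc (l.foldl (fun s x => step (a, x, s)) st) ∧ (∀ x < b, s' x = s x) ∧
        t ≤ l.length * (K + 20) + 2 := by
  induction l with
  | nil =>
    intro st s h0 h1 h2 _
    exact ⟨s, _, Run.loop_false h1, h2, fun _ _ => rfl, by simp [Expr.cost]⟩
  | cons y l ih =>
    intro st s h0 h1 h2 hT
    have r0 := Run.assign' (x := b + 3)
      (e := .cons (.var b) (.cons (.hd (.var (b + 1))) (.var (b + 2)))) (s := s)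
      (v := enc (a, y, st)) (by simp only [Expr.eval, h0, h1, h2]; rfl)
    obtain ⟨s1, t1, r1, e1, p1, l1⟩ :=
      hc (b + 3) (Function.update s (b + 3) (enc (a, y, st))) (a, y, st) (by simp)
    have p1' : ∀ x < b + 3, s1 x = s x := fun x hx => by
      rw [p1 x hx, Function.update_of_ne hx.ne]
    have r2 := Run.assign' (x := b + 2) (e := .var (b + 3)) (s := s1) e1
    have r3 := Run.assign' (x := b + 1) (e := .tl (.var (b + 1)))
      (s := Function.update s1 (b + 2) (enc (step (a, y, st)))) (v := enc l)
      (by simp [Expr.eval, p1', h1, enc, Val.ofList, Val.tl])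
    obtain ⟨s4, t4, r4, e4, p4, l4⟩ := ih (step (a, y, st)) (Function.update
      (Function.update s1 (b + 2) (enc (step (a, y, st)))) (b + 1) (enc l))
      (by simp [p1', h0]) (by simp) (by simp)
      (fun l₁ x l₂ h => hT (y :: l₁) x l₂ (by simp [h]))
    refine ⟨s4, _, Run.loop_true (by simp [Expr.eval, h1, enc, Val.ofList])
      (r0.seq (r1.seq (r2.seq r3))) r4, e4, fun x hx => ?_, ?_⟩
    · rw [p4 x hx, Function.update_of_ne (by omega), Function.update_of_ne (by omega),
        p1' x (by omega)]
    · have := hT [] y l rfl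
      simp only [List.foldl_nil] at this
      simp only [Expr.cost, List.length_cons, Nat.add_mul]
      omega

/-- Folding over a list is polynomial-time if the intermediate values stay small. -/
theorem foldl {σ : Type} [Enc σ] {l : α → List β} {init : α → σ} {step : α → σ → β → σ}
    (hl : PF l) (hi : PF init) (hst : PF fun p : α × β × σ => step p.1 p.2.2 p.2.1)
    {B : α → ℕ} (hB : PolyBdd B)
    (hsz : ∀ a l₁, l₁ <+: l a → sz (l₁.foldl (step a) (init a)) ≤ B a) :
    PF fun a => (l a).foldl (step a) (init a) := by
  obtain ⟨⟨c, T, hT, hc⟩, hs⟩ := hl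
  obtain ⟨⟨d, U, hU, hd⟩, hs'⟩ := hi
  obtain ⟨⟨e, W, ⟨p, hp⟩, he⟩, -⟩ := hst
  -- Bounds the time of each step: its input `(a, x, state)` consists of `a`, an entry `x` of `l a`,
  -- a state of size at most `B a`, and two pairing nodes.
  set K : α → ℕ := fun a => p.eval (sz a + (sz (l a) + B a + 1) + 1)
  have hK : PolyBdd K := ((PolyBdd.size.add ((hs.add hB).add (.const 1))).add (.const 1)).polyComp p
  have hsum := (hT.add hU).add ((hs.mul (hK.add (.const 20))).add (.const 20))
  refine ⟨⟨fun b => .seq (.assign (b + 1) (.var b)) (.seq (c (b + 1))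
    (.seq (.assign (b + 2) (.var b)) (.seq (d (b + 2)) (.seq
      (.loop (.var (b + 1)) (.seq
          (.assign (b + 3) (.cons (.var b) (.cons (.hd (.var (b + 1))) (.var (b + 2)))))
          (.seq (e (b + 3)) (.seq (.assign (b + 2) (.var (b + 3)))
            (.assign (b + 1) (.tl (.var (b + 1))))))))
      (.assign b (.var (b + 2))))))), _, hsum, ?_⟩,
    hB.of_le fun a => hsz a _ List.prefix_rfl⟩
  intro b s a h
  have r0 := Run.assign (b + 1) (.var b) s
  obtain ⟨s1, t1, r1, e1, p1, l1⟩ := hc (b + 1) (Function.update s (b + 1) (s b)) a (by simpa)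
  have r2 := Run.assign (b + 2) (.var b) s1
  have hb : s1 b = enc a := by rw [p1 b (by omega), Function.update_of_ne (by omega), h]
  obtain ⟨s3, t3, r3, e3, p3, l3⟩ := hd (b + 2) (Function.update s1 (b + 2) (s1 b)) a (by simpa)
  have hb1 : s3 (b + 1) = enc (l a) := by
    rw [p3 _ (by omega), Function.update_of_ne (by omega), e1]
  have hb0 : s3 b = enc a := by
    rw [p3 _ (by omega), Function.update_of_ne (by omega), hb]
  obtain ⟨s4, t4, r4, e4, p4, l4⟩ := run_foldl_loop he b a (K a) (l a) (init a) s3 hb0 hb1 e3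
    (by
      intro l₁ x l₂ h
      refine (hp _).trans (poly_mono p ?_)
      have h1 : sz (l₁.foldl (fun s x => step a s x) (init a)) ≤ B a := hsz a l₁ ⟨_, h.symm⟩
      have h2 : sz x ≤ sz (l a) := sz_le_of_mem (by simp [h])
      rw [sz_pair, sz_pair]
      dsimp only
      omega)
  refine ⟨_, _, r0.seq (r1.seq (r2.seq (r3.seq (r4.seq (Run.assign' (e := .var (b + 2)) e4))))),
    by simp, fun x hx => ?_, ?_⟩
  · rw [Function.update_of_ne (by omega), p4 _ hx, p3 _ (by omega),
      Function.update_of_ne (by omega), p1 _ (by omega), Function.update_of_ne (by omega)]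
  · have : (l a).length * (K a + 20) ≤ sz (l a) * (K a + 20) :=
      Nat.mul_le_mul_right _ (length_le_sz _)
    simp only [Expr.cost]; omega

theorem foldl_cons_eq {β : Type} (l m : List β) : l.foldl (fun acc x => x :: acc) m = l.reverse ++ m := by
  induction l generalizing m with
  | nil => rfl
  | cons a l ih => simp [ih]

theorem revAppend {f g : α → List β} (hf : PF f) (hg : PF g) :
    PF fun a => (f a).reverse ++ g a :=
  (foldl (step := fun _ acc x => x :: acc) hf hg (cons snd'.fst snd'.snd)
    (hf.size.add hg.size) (fun a l₁ h => by
      rw [foldl_cons_eq]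
      have := sz_append l₁.reverse (g a)
      have := sz_sublist h.sublist
      simp at *
      omega)).congr fun a => foldl_cons_eq _ _

theorem reverse {f : α → List β} (hf : PF f) : PF fun a => (f a).reverse :=
  (revAppend hf nil).congr fun _ => List.append_nil _

theorem append {f g : α → List β} (hf : PF f) (hg : PF g) : PF fun a => f a ++ g a :=
  (revAppend hf.reverse hg).congr fun a => by simp

/-- The head is the last entry met when folding over the reversed list. -/
theorem headD {f : α → List β} {g : α → β} (hf : PF f) (hg : PF g) :
    PF fun a => (f a).headD (g a) :=
  (foldl (step := fun _ _ x => x) hf.reverse hg snd'.fst (hf.size.add hg.size) (fun a l₁ h => by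
    rcases List.eq_nil_or_concat l₁ with rfl | ⟨l, x, rfl⟩
    · simp
    · have : x ∈ (f a).reverse := h.subset (by simp)
      have := sz_le_of_mem (List.mem_reverse.1 this)
      simp
      omega)).congr fun a => by
        cases f a <;> simp

/-- Mapping a function over a list. -/
theorem map {l : α → List β} {f : α → β → γ} (hl : PF l) (hf : PF fun p : α × β => f p.1 p.2) :
    PF fun a => (l a).map (f a) := by
  have key : ∀ (a : α) (m : List β) (acc : List γ),
      m.foldl (fun acc x => f a x :: acc) acc = (m.map (f a)).reverse ++ acc := by
    intro a m
    induction m with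
    | nil => simp
    | cons x m ih => simp [ih]
  obtain ⟨p, hp⟩ := hf.size
  have hst : PF fun p : α × β × List γ => f p.1 p.2.1 :: p.2.2 :=
    cons (comp₂ hf fst' snd'.fst) snd'.snd
  have hB := (hl.size.mul ((((PolyBdd.size.add hl.size).add (.const 1)).polyComp p).add
    (.const 1))).add (.const 1)
  refine (foldl (step := fun a acc x => f a x :: acc) hl nil hst hB fun a l₁ h => ?_).reverse.congr
    fun a => by simp [key]
  rw [key, List.append_nil, sz_reverse]
  refine (sz_list_le (B := p.eval (sz a + sz (l a) + 1)) fun x hx => ?_).trans ?_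
  · obtain ⟨y, hy, rfl⟩ := List.mem_map.1 hx
    refine (hp (a, y)).trans (poly_mono p ?_)
    have : sz y ≤ sz (l a) := sz_le_of_mem (h.subset hy)
    rw [sz_pair]
    omega
  · gcongr
    rw [List.length_map]
    exact h.length_le.trans (length_le_sz _)

theorem and {f g : α → Bool} (hf : PF f) (hg : PF g) : PF fun a => f a && g a :=
  (ite hf hg false).congr fun a => by cases f a <;> simp

theorem or {f g : α → Bool} (hf : PF f) (hg : PF g) : PF fun a => f a || g a :=
  (ite hf true hg).congr fun a => by cases f a <;> simp

theorem not {f : α → Bool} (hf : PF f) : PF fun a => !f a :=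
  (ite hf false true).congr fun a => by cases f a <;> simp

theorem beqBool {f g : α → Bool} (hf : PF f) (hg : PF g) : PF fun a => f a == g a :=
  (ite hf hg hg.not).congr fun a => by cases f a <;> cases g a <;> rfl

theorem any {l : α → List β} {q : α → β → Bool} (hl : PF l) (hq : PF fun p : α × β => q p.1 p.2) :
    PF fun a => (l a).any (q a) := by
  have key : ∀ (a : α) (m : List β) (acc : Bool),
      m.foldl (fun acc x => acc || q a x) acc = (acc || m.any (q a)) := by
    intro a m
    induction m with
    | nil => simp
    | cons x m ih => simp [ih, Bool.or_assoc]
  exact (foldl (step := fun a acc x => acc || q a x) hl false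
    (or snd'.snd (comp₂ hq fst' snd'.fst)) (.const 3) fun a l₁ _ => sz_bool_le _).congr
    fun a => by simp [key]

theorem all {l : α → List β} {q : α → β → Bool} (hl : PF l) (hq : PF fun p : α × β => q p.1 p.2) :
    PF fun a => (l a).all (q a) :=
  (any hl hq.not).not.congr fun a => by
    rw [← List.not_all_eq_any_not, Bool.not_not]

theorem flatten {l : α → List (List β)} (hl : PF l) : PF fun a => (l a).flatten := by
  have key : ∀ (m : List (List β)) (acc : List β),
      m.foldl (fun acc x => acc ++ x) acc = acc ++ m.flatten := by
    intro m
    induction m with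
    | nil => simp
    | cons x m ih => simp [ih]
  refine (foldl (step := fun _ acc x => acc ++ x) hl nil (append snd'.snd snd'.fst) hl.size
    fun a l₁ h => ?_).congr fun a => by simp [key]
  rw [key, List.nil_append]
  refine le_trans ?_ (sz_sublist h.sublist)
  clear h
  induction l₁ with
  | nil => simp
  | cons x m ih =>
    have := sz_append x m.flatten
    simp
    omega

theorem flatMap {l : α → List β} {f : α → β → List γ} (hl : PF l)
    (hf : PF fun p : α × β => f p.1 p.2) : PF fun a => (l a).flatMap (f a) :=
  (map hl hf).flatten.congr fun _ => List.flatMap_def.symm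

theorem filter {l : α → List β} {q : α → β → Bool} (hl : PF l)
    (hq : PF fun p : α × β => q p.1 p.2) : PF fun a => (l a).filter (q a) :=
  (flatMap (f := fun a x => if q a x then [x] else []) hl (ite hq (cons snd' nil) nil)).congr
    fun a => by
      induction l a with
      | nil => rfl
      | cons x m ih => by_cases h : q a x <;> simp [h, ih]

/-- Turns a number into a list to fold over, at no cost since both are the same tree. Bounded
iteration and arithmetic rest on this. -/
theorem units {f : α → ℕ} (hf : PF f) : PF fun a => List.replicate (f a) () :=
  comp (g := fun n : ℕ => List.replicate n ())
    (of_expr (fun b => .var b) 1 (fun _ => le_rfl)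
      (fun _ _ a h => by
        simp only [Expr.eval, h, enc, Val.ofNatUnary, List.map_replicate])
      (PolyBdd.size.of_le fun n => by
        have : sz (List.replicate n ()) = 2 * n + 1 := by
          induction n with
          | zero => rfl
          | succ n ih => simp [List.replicate_succ, ih]; omega
        simp [this])) hf

theorem length {l : α → List β} (hl : PF l) : PF fun a => (l a).length := by
  have h : PF fun a => (l a).map fun _ => () :=
    map hl (of_expr (fun _ => .nil) 1 (fun _ => le_rfl) (fun _ _ _ _ => rfl) (.const 1))
  have h' : PF fun l : List Unit => l.length :=
    of_expr (fun b => .var b) 1 (fun _ => le_rfl)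
      (fun _ _ a h => by
        simp only [Expr.eval, h, enc, Val.ofNatUnary, List.map_const'])
      (PolyBdd.size.of_le fun l => by
        induction l with
        | nil => rfl
        | cons a l ih => simp at *; omega)
  exact (h'.comp h).congr fun a => by simp

theorem foldl_units {σ : Type} (g : σ → σ) (n : ℕ) (x : σ) :
    (List.replicate n ()).foldl (fun y _ => g y) x = g^[n] x := by
  induction n generalizing x with
  | zero => rfl
  | succ n ih => simp [List.replicate_succ, ih]

/-- Iteration is polynomial-time if the iterates stay small. -/
theorem iterate {f : α → ℕ} {g : α → β → β} {x : α → β} (hf : PF f)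
    (hg : PF fun p : α × β => g p.1 p.2) (hx : PF x) {B : α → ℕ} (hB : PolyBdd B)
    (hsz : ∀ a, ∀ i ≤ f a, sz ((g a)^[i] (x a)) ≤ B a) : PF fun a => (g a)^[f a] (x a) :=
  (foldl (step := fun a y _ => g a y) hf.units hx (comp₂ hg fst' snd'.snd) hB
    (fun a l₁ h => by
      have h1 : l₁ = List.replicate l₁.length () := by simp [List.eq_replicate_iff]
      rw [h1, foldl_units]
      exact hsz a _ (by simpa using h.length_le))).congr fun a => foldl_units _ _ _

theorem add {f g : α → ℕ} (hf : PF f) (hg : PF g) : PF fun a => f a + g a :=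
  (length (append hf.units hg.units)).congr fun a => by simp

theorem mul {f g : α → ℕ} (hf : PF f) (hg : PF g) : PF fun a => f a * g a :=
  (length (flatMap (f := fun a _ => List.replicate (g a) ()) hf.units (hg.comp fst').units)).congr
    fun a => by simp

theorem sub {f g : α → ℕ} (hf : PF f) (hg : PF g) : PF fun a => f a - g a := by
  have key : ∀ n i : ℕ, (fun m => m - 1)^[i] n = n - i := by
    intro n i
    induction i with
    | zero => rfl
    | succ i ih => rw [Function.iterate_succ_apply', ih]; omega
  exact (iterate (g := fun _ m => m - 1) hg (pred snd') hf hf.size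
    fun a i _ => by rw [key, sz_nat, sz_nat]; omega).congr fun a => key _ _

theorem le {f g : α → ℕ} (hf : PF f) (hg : PF g) : PF fun a => decide (f a ≤ g a) :=
  (sub hf hg).isZero.congr fun a => by grind

theorem beqNat {f g : α → ℕ} (hf : PF f) (hg : PF g) : PF fun a => f a == g a :=
  (and (le hf hg) (le hg hf)).congr fun a => by
    grind

theorem beqPair {f g : α → ℕ × ℕ} (hf : PF f) (hg : PF g) : PF fun a => f a == g a :=
  (and (beqNat hf.fst hg.fst) (beqNat hf.snd hg.snd)).congr fun _ => rfl

theorem min {f g : α → ℕ} (hf : PF f) (hg : PF g) : PF fun a => Min.min (f a) (g a) :=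
  (ite (le hf hg) hf hg).congr fun a => by simp [min_def]

theorem containsNat {l : α → List ℕ} {f : α → ℕ} (hl : PF l) (hf : PF f) :
    PF fun a => (l a).contains (f a) :=
  (any (q := fun a x => f a == x) hl (beqNat (hf.comp fst') snd')).congr fun a => by
    rw [List.contains_eq_any_beq]

theorem containsPair {l : α → List (ℕ × ℕ)} {f : α → ℕ × ℕ} (hl : PF l) (hf : PF f) :
    PF fun a => (l a).contains (f a) :=
  (any (q := fun a x => f a == x) hl (beqPair (hf.comp fst') snd')).congr fun a => by
    rw [List.contains_eq_any_beq]

theorem range {f : α → ℕ} (hf : PF f) : PF fun a => List.range (f a) := by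
  have key : ∀ i : ℕ, (fun l : List ℕ => l ++ [l.length])^[i] [] = List.range i := by
    intro i
    induction i with
    | zero => rfl
    | succ i ih => rw [Function.iterate_succ_apply', ih]; simp [List.range_succ]
  refine (iterate (g := fun _ l => l ++ [l.length]) hf (append snd' (cons (length snd') nil)) nil
    ((hf.size.mul (hf.size.add (.const 1))).add (.const 1))
    fun a i hi => ?_).congr fun a => key _
  rw [key]
  refine (sz_list_le (B := sz (f a)) fun x hx => ?_).trans ?_
  · have := List.mem_range.1 hx
    simp
    omega
  · gcongr
    simp
    omega

theorem drop {l : α → List β} {f : α → ℕ} (hl : PF l) (hf : PF f) :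
    PF fun a => (l a).drop (f a) := by
  have key : ∀ (m : List β) (i : ℕ), List.tail^[i] m = m.drop i := by
    intro m i
    induction i with
    | zero => rfl
    | succ i ih => rw [Function.iterate_succ_apply', ih, List.tail_drop]
  exact (iterate (g := fun _ m => m.tail) hf (tail snd') hl hl.size fun a i _ => by
    rw [key]; exact sz_sublist (List.drop_sublist _ _)).congr fun a => key _ _

theorem getD {l : α → List β} {f : α → ℕ} {d : α → β} (hl : PF l) (hf : PF f) (hd : PF d) :
    PF fun a => (l a).getD (f a) (d a) :=
  (headD (drop hl hf) hd).congr fun a => by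
    rw [List.headD_eq_head?_getD, List.head?_drop, List.getD_eq_getElem?_getD]

theorem take {l : α → List β} {f : α → ℕ} (hl : PF l) (hf : PF f) :
    PF fun a => (l a).take (f a) :=
  (reverse (drop (reverse hl) (sub (length hl) hf))).congr fun a => by
    rw [List.drop_reverse, List.reverse_reverse]
    rcases le_total (f a) (l a).length with h | h
    · rw [Nat.sub_sub_self h]
    · rw [Nat.sub_eq_zero_of_le h, Nat.sub_zero, List.take_length, List.take_of_length_le h]

theorem sum {l : α → List ℕ} (hl : PF l) : PF fun a => (l a).sum :=
  (length (flatMap (f := fun _ n => List.replicate n ()) hl (units snd'))).congr fun a => by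
    simp [List.length_flatMap]

theorem foldlMin {l : α → List ℕ} {f : α → ℕ} (hl : PF l) (hf : PF f) :
    PF fun a => (l a).foldl Min.min (f a) :=
  foldl (step := fun _ x y => Min.min x y) hl hf (min snd'.snd snd'.fst) hf.size fun a l₁ _ => by
    have : ∀ (l : List ℕ) (x : ℕ), l.foldl Min.min x ≤ x := by
      intro l
      induction l with
      | nil => intro x; exact le_rfl
      | cons y l ih => intro x; exact (ih _).trans (min_le_left _ _)
    have := this l₁ (f a)
    simp
    omega

end PF

end WhileLang

namespace WhileLang

namespace PF

variable {α β γ : Type} [Enc α] [Enc β] [Enc γ]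

theorem foldr {σ : Type} [Enc σ] {l : α → List β} {init : α → σ} {step : α → β → σ → σ}
    (hl : PF l) (hi : PF init) (hst : PF fun p : α × β × σ => step p.1 p.2.1 p.2.2)
    {B : α → ℕ} (hB : PolyBdd B)
    (hsz : ∀ a l₁, l₁ <:+ l a → sz (l₁.foldr (step a) (init a)) ≤ B a) :
    PF fun a => (l a).foldr (step a) (init a) :=
  (foldl (step := fun a s x => step a x s) hl.reverse hi hst hB fun a l₁ h => by
    have := hsz a l₁.reverse (by simpa using List.reverse_suffix.2 h)
    rwa [List.foldr_reverse] at this).congr fun a => by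
      rw [List.foldl_reverse]

end PF

end WhileLang

/-! ### The decision procedure -/

namespace SteinerForest

open WhileLang

/-- Adjacency, read off the rows of the adjacency matrix. -/
def adjB (M : List (List Bool)) (i j : ℕ) : Bool := (M.getD i []).getD j false

/-- Adjacency after deleting the vertex `c` and the edges in `R`. -/
def linkB (M : List (List Bool)) (R : List (ℕ × ℕ)) (c u v : ℕ) : Bool :=
  adjB M u v && (!(u == c) && (!(v == c) && (!R.contains (u, v) && !R.contains (v, u))))

/-- The first neighbour of `b` other than `a`; it is `M.length` if there is none. -/
def nextV (M : List (List Bool)) (R : List (ℕ × ℕ)) (c a b : ℕ) : ℕ :=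
  ((List.range M.length).filter fun w => linkB M R c b w && !(w == a)).headD M.length

/-- One step of a walk that does not turn back. -/
def stepV (M : List (List Bool)) (R : List (ℕ × ℕ)) (c : ℕ) (p : ℕ × ℕ) : ℕ × ℕ :=
  (p.2, nextV M R c p.1 p.2)

/-- The first `l` vertices of the walk that starts with `u`, `v` and does not turn back. -/
def orbit (M : List (List Bool)) (R : List (ℕ × ℕ)) (c u v l : ℕ) : List ℕ :=
  (List.range l).map fun i => ((stepV M R c)^[i] (u, v)).1

/-- All initial segments of walks that do not turn back. -/
def candidates (M : List (List Bool)) (R : List (ℕ × ℕ)) (c : ℕ) : List (List ℕ) :=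
  (List.range M.length).flatMap fun u => (List.range M.length).flatMap fun v =>
    (List.range M.length).map fun l => orbit M R c u v (l + 1)

/-- `L` lists the vertices of a component along a path. -/
def isTrav (M : List (List Bool)) (R : List (ℕ × ℕ)) (c : ℕ) (L : List ℕ) : Bool :=
  (List.range (L.length - 1)).all (fun i => linkB M R c (L.getD i 0) (L.getD (i + 1) 0)) &&
    (!L.contains c &&
      L.all fun u => (List.range M.length).all fun w => !linkB M R c u w || L.contains w)

/-- No terminal pair has exactly one terminal in `s`. -/
def closedB (S : List (ℕ × ℕ)) (s : List ℕ) : Bool :=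
  S.all fun p => s.contains p.1 == s.contains p.2

/-- A number larger than the number of edges. -/
def infCost (M : List (List Bool)) : ℕ := M.length * M.length + 1

/-- The number of edges needed for a segment of a path: its own edges, and one edge to `c` if a
terminal pair leaves it. -/
def segCost (M : List (List Bool)) (S : List (ℕ × ℕ)) (c : ℕ) (s : List ℕ) : ℕ :=
  if closedB S s then s.length - 1 else if s.any (fun u => adjB M c u) then s.length else infCost M

/-- The next entry of the table of optimal costs. -/
def dpEntry (M : List (List Bool)) (S : List (ℕ × ℕ)) (c x : ℕ) (t T : List ℕ) : ℕ :=
  ((List.range (t.length + 1)).map fun i =>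
    segCost M S c ((x :: t).take (i + 1)) + T.getD i (infCost M)).foldl min (infCost M)

/-- One step of the dynamic program; the state is a suffix and the table of its costs. -/
def dpStep (M : List (List Bool)) (S : List (ℕ × ℕ)) (c x : ℕ) (st : List ℕ × List ℕ) :
    List ℕ × List ℕ :=
  (x :: st.1, dpEntry M S c x st.1 st.2 :: st.2)

/-- The optimal cost of a partition of a path into segments. -/
def dp (M : List (List Bool)) (S : List (ℕ × ℕ)) (c : ℕ) (L : List ℕ) : ℕ :=
  (L.foldr (dpStep M S c) ([], [0])).2.headD 0

/-- The cost of the component of `v`, charged to its smallest vertex. -/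
def cost (M : List (List Bool)) (S R : List (ℕ × ℕ)) (c v : ℕ) : ℕ :=
  -- For symmetric adjacency all traversals through `v` have the same vertex set, so whether `v` is
  -- smallest does not depend on `L`. The value 0 for the other vertices still certifies that a
  -- traversal exists; without one the result is `infCost M`.
  (((candidates M R c).filter fun L => isTrav M R c L && L.contains v).map fun L =>
    if L.all (fun u => decide (v ≤ u)) then dp M S c L else 0).foldl min (infCost M)

/-- The total cost over all components. -/
def total (M : List (List Bool)) (S R : List (ℕ × ℕ)) (c : ℕ) : ℕ :=
  ((List.range M.length).map fun v => if v == c then 0 else cost M S R c v).sum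

/-- All lists of length `r` with entries from `l`. -/
def tuples {α : Type} : ℕ → List α → List (List α)
  | 0, _ => [[]]
  | r + 1, l => l.flatMap fun x => (tuples r l).map fun t => x :: t

/-- All pairs of numbers below `m`. -/
def allPairs (m : ℕ) : List (ℕ × ℕ) :=
  (List.range m).flatMap fun i => (List.range m).map fun j => (i, j)

/-- The number with the given bits, capped at `m`. -/
def capped (m : ℕ) (bits : List Bool) : ℕ :=
  -- Capping after every bit keeps the unary value small; the budget itself may be exponential in
  -- its number of bits.
  bits.foldr (fun b k => min m (k + k + if b then 1 else 0)) 0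

/-- The decision procedure; `r` bounds the number of deleted edges. -/
def solve (r : ℕ) (I : List (List Bool) × List (ℕ × ℕ) × List Bool × Unit) : Bool :=
  -- The index `I.1.length` is not a vertex. As `c` it means that no vertex is deleted, and in pairs
  -- it pads `R` to length exactly `r`.
  (tuples r (allPairs (I.1.length + 1))).any fun R => (List.range (I.1.length + 1)).any fun c =>
    decide (total I.1 I.2.1 R c ≤ capped (I.1.length * I.1.length) I.2.2.1)

end SteinerForest

/-! ### The procedure runs in polynomial time -/

namespace WhileLang.PF

open SteinerForest

variable {α : Type} [Enc α]

theorem adjB {M : α → List (List Bool)} {i j : α → ℕ} (hM : PF M) (hi : PF i) (hj : PF j) :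
    PF fun a => adjB (M a) (i a) (j a) := getD (getD hM hi nil) hj false

theorem linkB {M : α → List (List Bool)} {R : α → List (ℕ × ℕ)} {c u v : α → ℕ} (hM : PF M)
    (hR : PF R) (hc : PF c) (hu : PF u) (hv : PF v) :
    PF fun a => linkB (M a) (R a) (c a) (u a) (v a) :=
  and (adjB hM hu hv) <| and (not (beqNat hu hc)) <| and (not (beqNat hv hc)) <|
    and (not (containsPair hR (pair hu hv))) (not (containsPair hR (pair hv hu)))

theorem nextV {M : α → List (List Bool)} {R : α → List (ℕ × ℕ)} {c u v : α → ℕ} (hM : PF M)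
    (hR : PF R) (hc : PF c) (hu : PF u) (hv : PF v) :
    PF fun a => nextV (M a) (R a) (c a) (u a) (v a) :=
  headD (filter (range (length hM)) (and
    (linkB (hM.comp fst') (hR.comp fst') (hc.comp fst') (hv.comp fst') snd')
    (not (beqNat snd' (hu.comp fst'))))) (length hM)

theorem nextV_le (M : List (List Bool)) (R : List (ℕ × ℕ)) (c a b : ℕ) :
    SteinerForest.nextV M R c a b ≤ M.length := by
  unfold SteinerForest.nextV
  generalize hl : List.filter _ _ = l
  cases l with
  | nil => simp
  | cons x l =>
    have : x ∈ x :: l := by simp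
    rw [← hl] at this
    simpa using (List.mem_range.1 (List.mem_filter.1 this).1).le

/-- Keeps the iterates small, as bounded iteration requires in `orbit`. -/
theorem iterate_stepV_le (M : List (List Bool)) (R : List (ℕ × ℕ)) (c u v i : ℕ) :
    ((stepV M R c)^[i] (u, v)).1 ≤ u + v + M.length ∧
      ((stepV M R c)^[i] (u, v)).2 ≤ u + v + M.length := by
  induction i with
  | zero => simp; omega
  | succ i ih =>
    rw [Function.iterate_succ_apply']
    have := nextV_le M R c ((stepV M R c)^[i] (u, v)).1 ((stepV M R c)^[i] (u, v)).2
    exact ⟨ih.2, by simp only [stepV]; omega⟩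

theorem orbit {M : α → List (List Bool)} {R : α → List (ℕ × ℕ)} {c u v l : α → ℕ} (hM : PF M)
    (hR : PF R) (hc : PF c) (hu : PF u) (hv : PF v) (hl : PF l) :
    PF fun a => orbit (M a) (R a) (c a) (u a) (v a) (l a) := by
  have h : PF fun p : α × ℕ => (stepV (M p.1) (R p.1) (c p.1))^[p.2] (u p.1, v p.1) :=
    iterate (g := fun (p : α × ℕ) q => stepV (M p.1) (R p.1) (c p.1) q) snd'
      (pair (snd snd') (nextV (hM.comp fst'.fst) (hR.comp fst'.fst) (hc.comp fst'.fst)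
        (fst snd') (snd snd')))
      (pair (hu.comp fst') (hv.comp fst'))
      (B := fun p : α × ℕ => 2 * (sz (u p.1) + sz (v p.1) + (sz (M p.1) + sz (M p.1)) + 1) + 1)
      (((PolyBdd.const 2).mul ((((hu.comp fst').size.add (hv.comp fst').size).add
        ((hM.comp fst').size.add (hM.comp fst').size)).add (.const 1))).add (.const 1))
      fun p i _ => by
        have := iterate_stepV_le (M p.1) (R p.1) (c p.1) (u p.1) (v p.1) i
        have hlen := length_le_sz (M p.1)
        change sz ((stepV (M p.1) (R p.1) (c p.1))^[i] (u p.1, v p.1)) ≤ _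
        have : sz ((stepV (M p.1) (R p.1) (c p.1))^[i] (u p.1, v p.1)) =
          sz ((stepV (M p.1) (R p.1) (c p.1))^[i] (u p.1, v p.1)).1 +
          sz ((stepV (M p.1) (R p.1) (c p.1))^[i] (u p.1, v p.1)).2 + 1 := rfl
        simp only [sz_nat] at *
        omega
  exact map (range hl) (fst h)

theorem candidates {M : α → List (List Bool)} {R : α → List (ℕ × ℕ)} {c : α → ℕ} (hM : PF M)
    (hR : PF R) (hc : PF c) : PF fun a => candidates (M a) (R a) (c a) :=
  flatMap (range (length hM)) <| flatMap (range (length (hM.comp fst'))) <|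
    map (range (length (hM.comp fst'.fst))) <|
      orbit (hM.comp fst'.fst.fst) (hR.comp fst'.fst.fst) (hc.comp fst'.fst.fst)
        (snd fst'.fst) (snd fst') (succ snd')

theorem isTrav {M : α → List (List Bool)} {R : α → List (ℕ × ℕ)} {c : α → ℕ} {L : α → List ℕ}
    (hM : PF M) (hR : PF R) (hc : PF c) (hL : PF L) : PF fun a => isTrav (M a) (R a) (c a) (L a) :=
  and (all (range (sub (length hL) (natConst 1)))
    (linkB (hM.comp fst') (hR.comp fst') (hc.comp fst') (getD (hL.comp fst') snd' (natConst 0))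
      (getD (hL.comp fst') (succ snd') (natConst 0)))) <|
  and (not (containsNat hL hc)) <| all hL <| all (range (length (hM.comp fst'))) <|
    or (not (linkB (hM.comp fst'.fst) (hR.comp fst'.fst) (hc.comp fst'.fst) (snd fst') snd'))
      (containsNat (hL.comp fst'.fst) snd')

theorem closedB {S : α → List (ℕ × ℕ)} {s : α → List ℕ} (hS : PF S) (hs : PF s) :
    PF fun a => closedB (S a) (s a) :=
  all hS (beqBool (containsNat (hs.comp fst') (fst snd')) (containsNat (hs.comp fst') (snd snd')))

theorem infCost {M : α → List (List Bool)} (hM : PF M) : PF fun a => infCost (M a) :=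
  succ (mul (length hM) (length hM))

theorem segCost {M : α → List (List Bool)} {S : α → List (ℕ × ℕ)} {c : α → ℕ} {s : α → List ℕ}
    (hM : PF M) (hS : PF S) (hc : PF c) (hs : PF s) :
    PF fun a => segCost (M a) (S a) (c a) (s a) :=
  ite (closedB hS hs) (pred (length hs)) (ite
    (any hs (adjB (hM.comp fst') (hc.comp fst') snd')) (length hs) (infCost hM))

theorem dpEntry {M : α → List (List Bool)} {S : α → List (ℕ × ℕ)} {c x : α → ℕ}
    {t T : α → List ℕ} (hM : PF M) (hS : PF S) (hc : PF c) (hx : PF x) (ht : PF t) (hT : PF T) :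
    PF fun a => dpEntry (M a) (S a) (c a) (x a) (t a) (T a) :=
  foldlMin (map (range (succ (length ht))) (add
    (segCost (hM.comp fst') (hS.comp fst') (hc.comp fst')
      (take (cons (hx.comp fst') (ht.comp fst')) (succ snd')))
    (getD (hT.comp fst') snd' (infCost (hM.comp fst'))))) (infCost hM)

theorem foldlMin_le (l : List ℕ) (x : ℕ) : l.foldl Min.min x ≤ x := by
  induction l generalizing x with
  | nil => exact le_rfl
  | cons y l ih => exact (ih _).trans (min_le_left _ _)

/-- Every new entry is a minimum that includes `infCost M`, so the table does not grow beyond that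
value however large the sums are. -/
theorem dp_state_bound (M : List (List Bool)) (S : List (ℕ × ℕ)) (c : ℕ) (L : List ℕ) :
    (L.foldr (dpStep M S c) ([], [0])).1 = L ∧
      (L.foldr (dpStep M S c) ([], [0])).2.length = L.length + 1 ∧
      ∀ y ∈ (L.foldr (dpStep M S c) ([], [0])).2, y ≤ SteinerForest.infCost M := by
  induction L with
  | nil => simp
  | cons x L ih =>
    simp only [List.foldr_cons, dpStep]
    refine ⟨by rw [ih.1], by simp [ih.2.1], fun y hy => ?_⟩
    rcases List.mem_cons.1 hy with rfl | hy
    · exact foldlMin_le _ _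
    · exact ih.2.2 y hy

theorem dp {M : α → List (List Bool)} {S : α → List (ℕ × ℕ)} {c : α → ℕ} {L : α → List ℕ}
    (hM : PF M) (hS : PF S) (hc : PF c) (hL : PF L) : PF fun a => dp (M a) (S a) (c a) (L a) := by
  have hst : PF fun p : α × ℕ × List ℕ × List ℕ =>
      dpStep (M p.1) (S p.1) (c p.1) p.2.1 p.2.2 :=
    pair (cons (fst snd') (fst (snd snd'))) (cons (dpEntry (hM.comp fst') (hS.comp fst')
      (hc.comp fst') (fst snd') (fst (snd snd')) (snd (snd snd'))) (snd (snd snd')))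
  refine headD (snd (foldr (step := fun a => dpStep (M a) (S a) (c a)) hL
    (pair nil (cons zero nil)) hst
    (B := fun a => sz (L a) + ((sz (L a) + 1) * (sz (SteinerForest.infCost (M a)) + 1) + 1) + 1)
    ((hL.size.add (((hL.size.add (.const 1)).mul ((infCost hM).size.add (.const 1))).add
      (.const 1))).add (.const 1))
    fun a l₁ h => ?_)) zero
  obtain ⟨h1, h2, h3⟩ := dp_state_bound (M a) (S a) (c a) l₁
  have h4 := sz_sublist h.sublist
  have h5 : sz (l₁.foldr (dpStep (M a) (S a) (c a)) ([], [0])) =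
    sz (l₁.foldr (dpStep (M a) (S a) (c a)) ([], [0])).1 +
    sz (l₁.foldr (dpStep (M a) (S a) (c a)) ([], [0])).2 + 1 := rfl
  have h6 := sz_list_le (B := sz (SteinerForest.infCost (M a))) fun y hy => by
    have := h3 y hy
    rw [sz_nat, sz_nat]
    omega
  rw [h2] at h6
  have h7 : (l₁.length + 1) * (sz (SteinerForest.infCost (M a)) + 1) ≤
      (sz (L a) + 1) * (sz (SteinerForest.infCost (M a)) + 1) :=
    Nat.mul_le_mul_right _ (by have := length_le_sz l₁; omega)
  rw [h5, h1]
  omega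

theorem cost {M : α → List (List Bool)} {S R : α → List (ℕ × ℕ)} {c v : α → ℕ}
    (hM : PF M) (hS : PF S) (hR : PF R) (hc : PF c) (hv : PF v) :
    PF fun a => cost (M a) (S a) (R a) (c a) (v a) :=
  foldlMin (map (filter (candidates hM hR hc) (and
    (isTrav (hM.comp fst') (hR.comp fst') (hc.comp fst') snd') (containsNat snd' (hv.comp fst'))))
    (ite (all snd' (le (hv.comp fst'.fst) snd'))
      (dp (hM.comp fst') (hS.comp fst') (hc.comp fst') snd') zero)) (infCost hM)

theorem total {M : α → List (List Bool)} {S R : α → List (ℕ × ℕ)} {c : α → ℕ}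
    (hM : PF M) (hS : PF S) (hR : PF R) (hc : PF c) : PF fun a => total (M a) (S a) (R a) (c a) :=
  sum (map (range (length hM)) (ite (beqNat snd' (hc.comp fst')) zero
    (cost (hM.comp fst') (hS.comp fst') (hR.comp fst') (hc.comp fst') snd')))

theorem tuples {β : Type} [Enc β] {l : α → List β} (r : ℕ) (hl : PF l) :
    PF fun a => tuples r (l a) := by
  induction r with
  | zero => exact cons nil nil
  | succ r ih => exact flatMap hl (map (ih.comp fst') (cons (snd fst') snd'))

theorem allPairs {f : α → ℕ} (hf : PF f) : PF fun a => allPairs (f a) :=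
  flatMap (range hf) (map (range (hf.comp fst')) (pair (snd fst') snd'))

theorem capped {f : α → ℕ} {l : α → List Bool} (hf : PF f) (hl : PF l) :
    PF fun a => capped (f a) (l a) :=
  foldr (step := fun a (b : Bool) (k : ℕ) => Min.min (f a) (k + k + if b then 1 else 0)) hl zero
    (min (hf.comp fst') (add (add (snd snd') (snd snd')) (ite (fst snd') (natConst 1) zero)))
    hf.size fun a l₁ _ => by
      cases l₁ with
      | nil => simp
      | cons b l => simp

theorem solve (r : ℕ) : PF (solve r) :=
  any (tuples r (allPairs (succ (length fst')))) <| any (range (succ (length (fst fst')))) <|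
    le (total (fst fst'.fst) (fst (snd fst'.fst)) (snd fst') snd')
      (capped (mul (length (fst fst'.fst)) (length (fst fst'.fst))) (fst (snd (snd fst'.fst))))

end WhileLang.PF

namespace SteinerForest

open SimpleGraph

/-! ### The recursion satisfied by the dynamic program -/

section DynamicProgram

variable (M : List (List Bool)) (S R : List (ℕ × ℕ)) (c : ℕ)

theorem foldl_min_le (l : List ℕ) (x : ℕ) : l.foldl min x ≤ x := WhileLang.PF.foldlMin_le l x

theorem foldl_min_le_of_mem {l : List ℕ} {y : ℕ} (hy : y ∈ l) (x : ℕ) : l.foldl min x ≤ y := by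
  induction l generalizing x with
  | nil => simp at hy
  | cons z l ih =>
    rcases List.mem_cons.1 hy with rfl | hy
    · exact (foldl_min_le l (min x _)).trans (min_le_right _ _)
    · exact ih hy _

theorem foldl_min_mem (l : List ℕ) (x : ℕ) : l.foldl min x = x ∨ l.foldl min x ∈ l := by
  induction l generalizing x with
  | nil => simp
  | cons z l ih =>
    rcases ih (min x z) with h | h
    · rcases min_choice x z with h' | h'
      · left; rw [List.foldl_cons, h, h']
      · right; rw [List.foldl_cons, h, h']; simp
    · right; rw [List.foldl_cons]; simp [h]

/-- The table of the costs of all suffixes. -/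
def dpTable (L : List ℕ) : List ℕ := (L.foldr (dpStep M S c) ([], [0])).2

theorem dpTable_cons (x : ℕ) (L : List ℕ) :
    dpTable M S c (x :: L) = dpEntry M S c x L (dpTable M S c L) :: dpTable M S c L := by
  simp only [dpTable, List.foldr_cons, dpStep]
  rw [(WhileLang.PF.dp_state_bound M S c L).1]

/-- Entry `i` of the table is the optimal cost of the suffix that remains after `i` vertices; within
this range the default `d` plays no role. -/
theorem dpTable_getD (L : List ℕ) (i d : ℕ) (hi : i ≤ L.length) :
    (dpTable M S c L).getD i d = dp M S c (L.drop i) := by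
  induction L generalizing i with
  | nil =>
    obtain rfl : i = 0 := by simpa using hi
    simp [dpTable, dp]
  | cons x L ih =>
    cases i with
    | zero =>
      change _ = (dpTable M S c (x :: L)).headD 0
      rw [dpTable_cons]
      simp
    | succ i =>
      rw [dpTable_cons]
      simpa using ih i (by simpa using hi)

theorem dp_cons (x : ℕ) (L : List ℕ) :
    dp M S c (x :: L) = ((List.range (L.length + 1)).map fun i =>
      segCost M S c ((x :: L).take (i + 1)) + dp M S c (L.drop i)).foldl min (infCost M) := by
  change (dpTable M S c (x :: L)).headD 0 = _
  rw [dpTable_cons, List.headD_cons, dpEntry]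
  congr 1
  refine List.map_congr_left fun i hi => ?_
  rw [dpTable_getD]
  have := List.mem_range.1 hi
  omega

/-- The cost of a path is at most the cost of a partition. -/
theorem dp_append_le (s L : List ℕ) (hs : s ≠ []) :
    dp M S c (s ++ L) ≤ segCost M S c s + dp M S c L := by
  cases s with
  | nil => exact absurd rfl hs
  | cons x s =>
    rw [List.cons_append, dp_cons]
    refine foldl_min_le_of_mem (List.mem_map.2 ⟨s.length, by simp, ?_⟩) _
    simp

/-- An optimal partition starts with some segment. -/
theorem exists_segment_of_dp_lt (x : ℕ) (L : List ℕ) (h : dp M S c (x :: L) < infCost M) :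
    ∃ s t, s ≠ [] ∧ x :: L = s ++ t ∧
      dp M S c (x :: L) = segCost M S c s + dp M S c t := by
  rw [dp_cons] at h ⊢
  rcases foldl_min_mem ((List.range (L.length + 1)).map fun i =>
      segCost M S c ((x :: L).take (i + 1)) + dp M S c (L.drop i)) (infCost M) with h' | h'
  · omega
  · obtain ⟨i, -, hi⟩ := List.mem_map.1 h'
    exact ⟨_, _, by simp, (List.take_append_drop (i + 1) (x :: L)).symm, by rw [← hi]; simp⟩

end DynamicProgram

theorem closedB_iff {S : List (ℕ × ℕ)} {s : List ℕ} :
    closedB S s = true ↔ ∀ p ∈ S, p.1 ∈ s ↔ p.2 ∈ s := by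
  simp only [closedB, List.all_eq_true]
  refine forall₂_congr fun p _ => ?_
  by_cases h1 : p.1 ∈ s <;> by_cases h2 : p.2 ∈ s <;> simp [h1, h2]

/-! ### Traversals of components -/

section Traversal

variable {M : List (List Bool)} {S R : List (ℕ × ℕ)} {c : ℕ} {G : SimpleGraph ℕ}

theorem linkB_iff {u v : ℕ} : linkB M R c u v = true ↔
    adjB M u v = true ∧ u ≠ c ∧ v ≠ c ∧ (u, v) ∉ R ∧ (v, u) ∉ R := by
  simp [linkB]

theorem isTrav_iff {L : List ℕ} : isTrav M R c L = true ↔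
    L.IsChain (fun u v => linkB M R c u v = true) ∧ c ∉ L ∧
      ∀ u ∈ L, ∀ w < M.length, linkB M R c u w = true → w ∈ L := by
  simp only [isTrav, Bool.and_eq_true, List.all_eq_true, List.mem_range, Bool.not_eq_true',
    Bool.or_eq_true, List.isChain_iff_getElem]
  refine and_congr ?_ (and_congr ?_ ?_)
  · constructor
    · intro h i hi
      have := h i (by omega)
      rwa [List.getD_eq_getElem _ _ (by omega), List.getD_eq_getElem _ _ (by omega)] at this
    · intro h i hi
      rw [List.getD_eq_getElem _ _ (by omega), List.getD_eq_getElem _ _ (by omega)]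
      exact h i (by omega)
  · simp
  · refine forall₂_congr fun u _ => forall₂_congr fun w _ => ?_
    cases linkB M R c u w <;> simp

/-- A chain that meets a set closed under its relation is contained in it. -/
theorem IsChain.subset_of_closed {r : ℕ → ℕ → Prop} (hr : ∀ u v, r u v → r v u) {L : List ℕ}
    (h : L.IsChain r) {P : ℕ → Prop} (hP : ∀ u w, P u → r u w → P w) {x : ℕ} (hx : x ∈ L)
    (hPx : P x) : ∀ u ∈ L, P u := by
  induction L generalizing x with
  | nil => simp at hx
  | cons a L ih =>
    cases L with
    | nil => simp_all
    | cons b L =>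
      rw [List.isChain_cons_cons] at h
      have hb : P b := by
        rcases List.mem_cons.1 hx with rfl | hx
        · exact hP _ _ hPx h.1
        · exact ih h.2 hx hPx b (by simp)
      intro u hu
      rcases List.mem_cons.1 hu with rfl | hu
      · exact hP _ _ hb (hr _ _ h.1)
      · exact ih h.2 (x := b) (by simp) hb u hu

end Traversal

/-! ### Soundness: a finite total is realised by a solution -/

section Soundness

variable {M : List (List Bool)} {S R : List (ℕ × ℕ)} {c : ℕ} {G : SimpleGraph ℕ}

/-- The graph with a given finite edge set. -/
abbrev ofEdges (E : Finset (Sym2 ℕ)) : SimpleGraph ℕ := fromEdgeSet (E : Set (Sym2 ℕ))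

theorem ofEdges_mono {E E' : Finset (Sym2 ℕ)} (h : E ⊆ E') : ofEdges E ≤ ofEdges E' :=
  fromEdgeSet_mono (Finset.coe_subset.2 h)

/-- Take the edges between consecutive entries. Repeated vertices only lower the number of edges, so
traversals need not be checked for repetitions. -/
theorem exists_edges_of_chain (s : List ℕ) (h : s.IsChain G.Adj) :
    ∃ E : Finset (Sym2 ℕ), (E : Set (Sym2 ℕ)) ⊆ G.edgeSet ∧ E.card ≤ s.length - 1 ∧
      ∀ u ∈ s, ∀ v ∈ s, (ofEdges E).Reachable u v := by
  induction s with
  | nil => exact ⟨∅, by simp, by simp, by simp⟩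
  | cons a s ih =>
    cases s with
    | nil => exact ⟨∅, by simp, by simp, by simp⟩
    | cons b s =>
      rw [List.isChain_cons_cons] at h
      obtain ⟨E, hE, hc, hr⟩ := ih h.2
      have hab : (ofEdges (insert s(a, b) E)).Reachable a b :=
        Adj.reachable (by simp [h.1.ne])
      have hmono := ofEdges_mono (Finset.subset_insert s(a, b) E)
      have key : ∀ u ∈ a :: b :: s, (ofEdges (insert s(a, b) E)).Reachable u b := by
        intro u hu
        rcases List.mem_cons.1 hu with rfl | hu
        · exact hab
        · exact (hr u hu b (by simp)).mono hmono
      refine ⟨insert s(a, b) E, ?_, ?_, fun u hu v hv => (key u hu).trans (key v hv).symm⟩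
      · rw [Finset.coe_insert, Set.insert_subset_iff]
        exact ⟨h.1, hE⟩
      · refine (Finset.card_insert_le _ _).trans ?_
        simp only [List.length_cons, Nat.add_sub_cancel] at hc ⊢
        omega

/-- The vertex `u` lies in a set that is connected in `F`, and that is closed under the terminal
pairs or connected to `c`. -/
def Covered (S : List (ℕ × ℕ)) (c : ℕ) (F : SimpleGraph ℕ) (L : List ℕ) (u : ℕ) : Prop :=
  ∃ s : List ℕ, u ∈ s ∧ s ⊆ L ∧ (∀ v ∈ s, ∀ w ∈ s, F.Reachable v w) ∧
    ((∀ p ∈ S, p.1 ∈ s ↔ p.2 ∈ s) ∨ ∀ v ∈ s, F.Reachable v c)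

theorem Covered.mono {F F' : SimpleGraph ℕ} (hF : F ≤ F') {L L' : List ℕ} (hL : L ⊆ L') {u : ℕ}
    (h : Covered S c F L u) : Covered S c F' L' u := by
  obtain ⟨s, hu, hs, hr, h⟩ := h
  exact ⟨s, hu, fun v hv => hL (hs hv), fun v hv w hw => (hr v hv w hw).mono hF,
    h.imp_right fun h v hv => (h v hv).mono hF⟩

/-- The three cases of `segCost`: a closed segment needs only its own path, another one also an edge
to `c`, and the third case is excluded by finiteness. -/
theorem exists_edges_of_segment (hM : ∀ i j, adjB M i j = true ↔ G.Adj i j) (s : List ℕ)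
    (h : s.IsChain G.Adj) (hs : segCost M S c s < infCost M) :
    ∃ E : Finset (Sym2 ℕ), (E : Set (Sym2 ℕ)) ⊆ G.edgeSet ∧ E.card ≤ segCost M S c s ∧
      ∀ u ∈ s, Covered S c (ofEdges E) s u := by
  obtain ⟨E, hE, hc, hr⟩ := exists_edges_of_chain s h
  unfold segCost at hs ⊢
  split_ifs at hs ⊢ with h1 h2
  · exact ⟨E, hE, hc, fun u hu => ⟨s, hu, List.Subset.refl _, hr, .inl (closedB_iff.1 h1)⟩⟩
  · obtain ⟨x, hx, hxc⟩ := List.any_eq_true.1 h2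
    rw [hM] at hxc
    have hmono := ofEdges_mono (Finset.subset_insert s(c, x) E)
    refine ⟨insert s(c, x) E, ?_, ?_, fun u hu => ⟨s, hu, List.Subset.refl _,
      fun v hv w hw => (hr v hv w hw).mono hmono, .inr fun v hv => ?_⟩⟩
    · rw [Finset.coe_insert, Set.insert_subset_iff]
      exact ⟨hxc, hE⟩
    · refine (Finset.card_insert_le _ _).trans ?_
      have := List.length_pos_of_mem hx
      omega
    · refine ((hr v hv x hx).mono hmono).trans (Adj.reachable ?_)
      simp [hxc.ne', Sym2.eq_swap]
  · omega

theorem exists_edges_of_dp (hM : ∀ i j, adjB M i j = true ↔ G.Adj i j) (n : ℕ) :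
    ∀ L : List ℕ, L.length ≤ n → L.IsChain G.Adj → dp M S c L < infCost M →
    ∃ E : Finset (Sym2 ℕ), (E : Set (Sym2 ℕ)) ⊆ G.edgeSet ∧ E.card ≤ dp M S c L ∧
      ∀ u ∈ L, Covered S c (ofEdges E) L u := by
  induction n with
  | zero =>
    intro L hn _ _
    obtain rfl := List.length_eq_zero_iff.1 (Nat.le_zero.1 hn)
    exact ⟨∅, by simp, by simp, by simp⟩
  | succ n ih =>
    intro L hn hL hdp
    cases L with
    | nil => exact ⟨∅, by simp, by simp, by simp⟩
    | cons x L =>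
      obtain ⟨s, t, hs, hst, he⟩ := exists_segment_of_dp_lt M S c x L hdp
      rw [he] at hdp ⊢
      rw [hst] at hL hn ⊢
      have hpos := List.length_pos_iff.2 hs
      obtain ⟨E, hE, hc, hr⟩ := exists_edges_of_segment hM s hL.left_of_append (S := S) (c := c)
        (by omega)
      obtain ⟨E', hE', hc', hr'⟩ := ih t (by simp at hn; omega) hL.right_of_append (by omega)
      refine ⟨E ∪ E', by simp [hE, hE'], (Finset.card_union_le _ _).trans (by omega),
        fun u hu => ?_⟩
      rcases List.mem_append.1 hu with hu | hu
      · exact (hr u hu).mono (ofEdges_mono Finset.subset_union_left) (by simp)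
      · exact (hr' u hu).mono (ofEdges_mono Finset.subset_union_right) (by simp)

theorem linkB_symm (hM : ∀ i j, adjB M i j = true ↔ G.Adj i j) {u v : ℕ}
    (h : linkB M R c u v = true) : linkB M R c v u = true := by
  rw [linkB_iff, hM] at *
  exact ⟨h.1.symm, h.2.2.1, h.2.1, h.2.2.2.2, h.2.2.2.1⟩

theorem linkB_adj (hM : ∀ i j, adjB M i j = true ↔ G.Adj i j) {u v : ℕ}
    (h : linkB M R c u v = true) : G.Adj u v := by
  rw [linkB_iff, hM] at *
  exact h.1

theorem linkB_lt (hM : ∀ i j, adjB M i j = true ↔ G.Adj i j) (hG : ∀ i j, G.Adj i j → i < M.length)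
    {u v : ℕ} (h : linkB M R c u v = true) : v < M.length :=
  hG _ _ (linkB_adj hM h).symm

/-- A traversal contains every traversal it meets. -/
theorem subset_of_isTrav (hM : ∀ i j, adjB M i j = true ↔ G.Adj i j)
    (hG : ∀ i j, G.Adj i j → i < M.length) {L L' : List ℕ} (hL : isTrav M R c L = true)
    (hL' : isTrav M R c L' = true) {x : ℕ} (hx : x ∈ L) (hx' : x ∈ L') : L ⊆ L' := by
  rw [isTrav_iff] at hL hL'
  exact IsChain.subset_of_closed (fun _ _ h => linkB_symm hM h) hL.1 (P := fun u => u ∈ L')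
    (fun u w hu h => hL'.2.2 u hu w (linkB_lt hM hG h) h) hx hx'

theorem mem_of_mem_candidates {L : List ℕ} : L ∈ candidates M R c ↔
    ∃ u < M.length, ∃ v < M.length, ∃ l < M.length, orbit M R c u v (l + 1) = L := by
  simp [candidates]

/-- A cost below `infCost M` is not the starting value of the minimum, so it is attained by a
traversal. -/
theorem exists_traversal_of_cost_lt {v : ℕ} (h : cost M S R c v < infCost M) :
    ∃ L, isTrav M R c L = true ∧ v ∈ L ∧
      ((∀ u ∈ L, v ≤ u) → cost M S R c v = dp M S c L) := by
  rcases foldl_min_mem (((candidates M R c).filter fun L => isTrav M R c L && L.contains v).map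
    fun L => if L.all (fun u => decide (v ≤ u)) then dp M S c L else 0) (infCost M) with h' | h'
  · exact absurd h' h.ne
  · obtain ⟨L, hL, he⟩ := List.mem_map.1 h'
    obtain ⟨-, hL⟩ := List.mem_filter.1 hL
    rw [Bool.and_eq_true, List.contains_iff_mem] at hL
    refine ⟨L, hL.1, hL.2, fun hv => ?_⟩
    rw [if_pos (by simpa using hv)] at he
    exact he.symm

theorem total_eq : total M S R c =
    ∑ v ∈ Finset.range M.length, if v = c then 0 else cost M S R c v := by
  rw [Finset.sum_range, total, ← List.sum_ofFn, List.ofFn_eq_map, ← List.map_coe_finRange_eq_range,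
    List.map_map]
  congr 1
  refine List.map_congr_left fun v _ => ?_
  by_cases h : (v : ℕ) = c <;> simp [h]

/-- Nothing is assumed about `R` and `c`: a poor guess may overestimate the optimum, but a total
below `infCost M` always comes from traversals of all components, and their segments supply the
edges. -/
theorem exists_forest_of_total_le (hM : ∀ i j, adjB M i j = true ↔ G.Adj i j)
    (hG : ∀ i j, G.Adj i j → i < M.length) (hS : ∀ p ∈ S, p.1 < M.length ∧ p.2 < M.length)
    (h : total M S R c < infCost M) :
    ∃ E : Finset (Sym2 ℕ), (E : Set (Sym2 ℕ)) ⊆ G.edgeSet ∧ E.card ≤ total M S R c ∧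
      ∀ p ∈ S, (ofEdges E).Reachable p.1 p.2 := by
  rw [total_eq] at h ⊢
  have hcost : ∀ v < M.length, v ≠ c → cost M S R c v < infCost M := by
    intro v hv hvc
    refine lt_of_le_of_lt ?_ h
    have := Finset.single_le_sum (f := fun v => if v = c then 0 else cost M S R c v)
      (fun _ _ => Nat.zero_le _) (Finset.mem_range.2 hv)
    simpa [hvc] using this
  choose! T hT1 hT2 hT3 using fun v (hv : v < M.length ∧ v ≠ c) =>
    exists_traversal_of_cost_lt (hcost v hv.1 hv.2)
  -- Edges are bought only at the smallest vertex of a component, so that each component is paid for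
  -- once.
  have hex : ∀ v, ∃ E : Finset (Sym2 ℕ), v < M.length → (E : Set (Sym2 ℕ)) ⊆ G.edgeSet ∧
      E.card ≤ (if v = c then 0 else cost M S R c v) ∧
      (v ≠ c → (∀ u ∈ T v, v ≤ u) → ∀ u ∈ T v, Covered S c (ofEdges E) (T v) u) := by
    intro v
    by_cases hv : (v < M.length ∧ v ≠ c) ∧ ∀ u ∈ T v, v ≤ u
    · have he := hT3 v hv.1 hv.2
      obtain ⟨E, h1, h2, h3⟩ := exists_edges_of_dp hM (S := S) (c := c) _ (T v) le_rfl
        ((isTrav_iff.1 (hT1 v hv.1)).1.imp fun _ _ h => linkB_adj hM h)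
        (he ▸ hcost v hv.1.1 hv.1.2)
      exact ⟨E, fun _ => ⟨h1, by rw [if_neg hv.1.2, he]; exact h2, fun _ _ => h3⟩⟩
    · exact ⟨∅, fun h => ⟨by simp, by simp, fun h' h'' => absurd ⟨⟨h, h'⟩, h''⟩ hv⟩⟩
  choose E hE using hex
  set F := (Finset.range M.length).biUnion E with hF
  have hcov : ∀ u < M.length, u ≠ c →
      ∃ L, Covered S c (ofEdges F) L u := by
    intro u hu huc
    have hne : (T u).toFinset.Nonempty := ⟨u, by simpa using hT2 u ⟨hu, huc⟩⟩
    -- The traversals chosen for `u` and for the smallest vertex `m` of its component may differ in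
    -- order but have the same vertices; hence the edges bought at `m` cover `u`.
    set m := (T u).toFinset.min' hne with hm
    have hmu : m ∈ T u := by simpa using (T u).toFinset.min'_mem hne
    have hmle : ∀ w ∈ T u, m ≤ w := fun w hw => Finset.min'_le _ _ (by simpa using hw)
    have hTu := isTrav_iff.1 (hT1 u ⟨hu, huc⟩)
    have hmc : m ≠ c := fun h => hTu.2.1 (h ▸ hmu)
    have hml : m < M.length := (hmle u (hT2 u ⟨hu, huc⟩)).trans_lt hu
    have hTm := hT1 m ⟨hml, hmc⟩
    have hsub := subset_of_isTrav hM hG hTm (hT1 u ⟨hu, huc⟩) (hT2 m ⟨hml, hmc⟩) hmu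
    have hsub' := subset_of_isTrav hM hG (hT1 u ⟨hu, huc⟩) hTm hmu (hT2 m ⟨hml, hmc⟩)
    refine ⟨T m, ((hE m hml).2.2 hmc (fun w hw => hmle w (hsub hw)) u
      (hsub' (hT2 u ⟨hu, huc⟩))).mono (ofEdges_mono ?_) (List.Subset.refl _)⟩
    exact Finset.subset_biUnion_of_mem E (Finset.mem_range.2 hml)
  refine ⟨F, ?_, ?_, fun p hp => ?_⟩
  · intro e he
    obtain ⟨v, hv, he⟩ := Finset.mem_biUnion.1 he
    exact (hE v (Finset.mem_range.1 hv)).1 he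
  · exact Finset.card_biUnion_le.trans
      (Finset.sum_le_sum fun v hv => (hE v (Finset.mem_range.1 hv)).2.1)
  · have key : ∀ u < M.length, (ofEdges F).Reachable u c ∨ ∃ s : List ℕ, u ∈ s ∧
        (∀ v ∈ s, ∀ w ∈ s, (ofEdges F).Reachable v w) ∧ (∀ p ∈ S, p.1 ∈ s ↔ p.2 ∈ s) := by
      intro u hu
      by_cases huc : u = c
      · exact .inl (huc ▸ Reachable.rfl)
      · obtain ⟨L, s, hus, -, hr, h⟩ := hcov u hu huc
        rcases h with h | h
        · exact .inr ⟨s, hus, hr, h⟩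
        · exact .inl (h u hus)
    -- If one terminal lies in a closed connected set, so does the other; if neither does, both are
    -- connected to `c`.
    rcases key p.1 (hS p hp).1 with h1 | ⟨s, h1, hr, hs⟩
    · rcases key p.2 (hS p hp).2 with h2 | ⟨s, h2, hr, hs⟩
      · exact h1.trans h2.symm
      · exact hr _ ((hs p hp).2 h2) _ h2
    · exact hr _ h1 _ ((hs p hp).1 h1)

end Soundness

end SteinerForest

namespace SteinerForest

open SimpleGraph

/-! ### Paths in acyclic graphs and in graphs of maximum degree two -/

section Paths

variable {F : SimpleGraph ℕ}

theorem exists_path_of_chain (a : ℕ) (l : List ℕ) (h : (a :: l).IsChain F.Adj)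
    (hn : (a :: l).Nodup) :
    ∃ p : F.Walk a ((a :: l).getLast (by simp)), p.IsPath ∧ p.support = a :: l := by
  induction l generalizing a with
  | nil => exact ⟨.nil, by simp, rfl⟩
  | cons b l ih =>
    rw [List.isChain_cons_cons] at h
    rw [List.nodup_cons] at hn
    obtain ⟨p, hp, hs⟩ := ih b h.2 hn.2
    refine ⟨(Walk.cons h.1 p).copy rfl (by simp), ?_, ?_⟩
    · rw [Walk.isPath_copy, Walk.cons_isPath_iff, hs]
      exact ⟨hp, hn.1⟩
    · rw [Walk.support_copy, Walk.support_cons, hs]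

/-- In an acyclic graph, adjacent vertices of a path are consecutive. -/
theorem eq_nil_of_adj (hF : F.IsAcyclic) {l₁ l₂ l₃ : List ℕ} {a b : ℕ}
    (h : (l₁ ++ (a :: l₂ ++ b :: l₃)).IsChain F.Adj) (hn : (l₁ ++ (a :: l₂ ++ b :: l₃)).Nodup)
    (hab : F.Adj a b) : l₂ = [] := by
  have e : a :: l₂ ++ b :: l₃ = (a :: (l₂ ++ [b])) ++ l₃ := by simp
  rw [e] at h hn
  have h' := h.right_of_append.left_of_append
  have hn' := (List.nodup_append.1 (List.nodup_append.1 hn).2.1).1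
  obtain ⟨p, hp, hs⟩ := exists_path_of_chain a _ h' hn'
  have hb : (a :: (l₂ ++ [b])).getLast (by simp) = b := by simp
  have hq : (Walk.cons hab Walk.nil : F.Walk a b).IsPath := by simp [hab.ne]
  -- The stretch of the list from `a` to `b` and the edge `ab` are both paths, so they coincide.
  have := (hF.subsingleton_path a b).elim ⟨p.copy rfl hb, by simpa using hp⟩ ⟨_, hq⟩
  have hs' := congrArg (fun q : F.Path a b => q.1.support) this
  simp only [Walk.support_copy, hs, Walk.support_cons, Walk.support_nil] at hs'
  cases l₂ with
  | nil => rfl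
  | cons x l => simp at hs'

/-- Every vertex of a finite graph of maximum degree two lies on a path that fills its
component. -/
theorem exists_traversal {n : ℕ} (hn : ∀ u v, F.Adj u v → u < n)
    (hdeg : ∀ v x y z, F.Adj v x → F.Adj v y → F.Adj v z → x = y ∨ x = z ∨ y = z) {v : ℕ}
    (hv : v < n) :
    ∃ L : List ℕ, L.Nodup ∧ L.IsChain F.Adj ∧ v ∈ L ∧ (∀ u ∈ L, u < n) ∧
      ∀ u ∈ L, ∀ w, F.Adj u w → w ∈ L := by
  -- A longest path through `v` works: a neighbour outside it would extend it if adjacent to an end,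
  -- and would be a third neighbour if adjacent to an inner vertex.
  let P : Set (List ℕ) := {L | L.Nodup ∧ L.IsChain F.Adj ∧ v ∈ L ∧ ∀ u ∈ L, u < n}
  have hbdd : BddAbove (List.length '' P) := by
    refine ⟨n, ?_⟩
    rintro _ ⟨L, ⟨h1, -, -, h2⟩, rfl⟩
    have : L.toFinset ⊆ Finset.range n := fun u hu => by simpa using h2 u (by simpa using hu)
    simpa [List.toFinset_card_of_nodup h1] using Finset.card_le_card this
  have hne : (List.length '' P).Nonempty := ⟨_, [v], by simp [P, hv], rfl⟩
  obtain ⟨L, ⟨h1, h2, h3, h4⟩, hL⟩ := Nat.sSup_mem hne hbdd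
  have hmax : ∀ L' ∈ P, L'.length ≤ L.length := fun L' h => hL ▸ le_csSup hbdd ⟨L', h, rfl⟩
  refine ⟨L, h1, h2, h3, h4, fun u hu w huw => ?_⟩
  by_contra hw
  have hwn := hn _ _ huw.symm
  obtain ⟨l₁, l₂, rfl⟩ := List.append_of_mem hu
  rcases List.eq_nil_or_concat l₁ with rfl | ⟨l₁, a, rfl⟩
  · have := hmax (w :: u :: l₂) ⟨List.nodup_cons.2 ⟨by simpa using hw, h1⟩,
      List.isChain_cons_cons.2 ⟨huw.symm, h2⟩, List.mem_cons_of_mem _ h3, fun x hx => by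
        rcases List.mem_cons.1 hx with rfl | hx
        · exact hwn
        · exact h4 x hx⟩
    simp at this
  · cases l₂ with
    | nil =>
      have := hmax ((l₁.concat a ++ [u]) ++ [w]) ⟨?_, ?_, List.mem_append_left _ h3, fun x hx => by
        rcases List.mem_append.1 hx with hx | hx
        · exact h4 x hx
        · simp at hx; omega⟩
      · simp at this
      · refine List.nodup_append.2 ⟨h1, by simp, ?_⟩
        rintro x hx y hy rfl
        obtain rfl : x = w := by simpa using hy
        exact hw hx
      · refine h2.append (by simp) ?_
        intro x hx y hy
        simp at hx hy
        subst hx hy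
        exact huw
    | cons b l₂ =>
      have e : l₁.concat a ++ u :: b :: l₂ = l₁ ++ ([a, u, b] ++ l₂) := by simp
      rw [e] at h1 h2 hw
      have h2' := h2.right_of_append.left_of_append
      have h1' := (List.nodup_append.1 (List.nodup_append.1 h1).2.1).1
      simp only [List.isChain_cons_cons] at h2'
      simp at h1' hw
      rcases hdeg u a b w h2'.1.symm h2'.2.1 huw with h | h | h
      · exact h1'.1.2 h
      · exact hw.2.1 h.symm
      · exact hw.2.2.2.1 h.symm

end Paths

/-! ### Spanning paths are among the candidates -/

section Candidates

variable {M : List (List Bool)} {R : List (ℕ × ℕ)} {c : ℕ}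

theorem nextV_eq {a b w : ℕ} (hw : linkB M R c b w = true) (hwn : w < M.length) (hwa : w ≠ a)
    (huniq : ∀ z, linkB M R c b z = true → z ≠ a → z = w) : nextV M R c a b = w := by
  unfold nextV
  generalize hl : List.filter _ _ = l
  have hmem : w ∈ l := by rw [← hl]; simp [hw, hwn, hwa]
  cases l with
  | nil => simp at hmem
  | cons x l =>
    have : x ∈ x :: l := by simp
    rw [← hl] at this
    simp only [List.mem_filter, Bool.and_eq_true, Bool.not_eq_true', beq_eq_false_iff_ne] at this
    exact huniq x this.2.1 this.2.2

/-- A path is determined by its first two vertices and its length: with degrees at most two, an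
inner vertex has only one neighbour besides its predecessor, so `nextV` must choose the successor.
-/
theorem mem_candidates {L : List ℕ} (hne : L ≠ []) (hnd : L.Nodup)
    (hch : L.IsChain fun u v => linkB M R c u v = true)
    (hsymm : ∀ u v, linkB M R c u v = true → linkB M R c v u = true)
    (hlt : ∀ u ∈ L, u < M.length)
    (hdeg : ∀ v x y z, linkB M R c v x = true → linkB M R c v y = true →
      linkB M R c v z = true → x = y ∨ x = z ∨ y = z) : L ∈ candidates M R c := by
  have hpos := List.length_pos_iff.2 hne
  have hlen : L.length ≤ M.length := by
    have : L.toFinset ⊆ Finset.range M.length := fun u hu => by simpa using hlt u (by simpa using hu)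
    simpa [List.toFinset_card_of_nodup hnd] using Finset.card_le_card this
  rw [List.isChain_iff_getElem] at hch
  rw [mem_of_mem_candidates]
  by_cases h1 : L.length = 1
  · obtain ⟨u, rfl⟩ := List.length_eq_one_iff.1 h1
    -- The second start vertex is never output in a walk of length one, so any vertex will do.
    exact ⟨u, hlt u (by simp), u, hlt u (by simp), 0, by simp at hlen; omega, rfl⟩
  have h2 : 1 < L.length := by omega
  refine ⟨L[0], hlt _ (by simp), L[1], hlt _ (by simp), L.length - 1, by omega, ?_⟩
  have key : ∀ i (hi : i + 1 < L.length),
      (stepV M R c)^[i] (L[0], L[1]) = (L[i], L[i + 1]) := by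
    intro i
    induction i with
    | zero => intro _; rfl
    | succ i ih =>
      intro hi
      rw [Function.iterate_succ_apply', ih (by omega), stepV]
      congr 1
      have hback := hsymm _ _ (hch i (by omega))
      have hne : L[i + 1 + 1] ≠ L[i] := fun h => by
        have := (hnd.getElem_inj_iff).1 h
        omega
      refine nextV_eq (hch (i + 1) hi) (hlt _ (by simp)) hne fun z hz hza => ?_
      rcases hdeg _ _ _ _ hback hz (hch (i + 1) hi) with h | h | h
      · exact absurd h.symm hza
      · exact absurd h.symm hne
      · exact h
  refine List.ext_getElem (by simp [orbit]; omega) fun i hi hi' => ?_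
  simp only [orbit, List.getElem_map, List.getElem_range]
  cases i with
  | zero => rfl
  | succ i => rw [Function.iterate_succ_apply', key i hi']; rfl

end Candidates

/-! ### Completeness: charging the total to the edges of a forest -/

section Charging

variable {M : List (List Bool)} {S R : List (ℕ × ℕ)} {c : ℕ} {G F : SimpleGraph ℕ}

open Classical in
/-- The edges in `E` that lie inside `t ∪ {c}`. -/
noncomputable def edgesIn (E : Finset (Sym2 ℕ)) (c : ℕ) (t : List ℕ) : Finset (Sym2 ℕ) :=
  E.filter fun e => ∀ u ∈ e, u ∈ t ∨ u = c

theorem mem_edgesIn {E : Finset (Sym2 ℕ)} {t : List ℕ} {e : Sym2 ℕ} :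
    e ∈ edgesIn E c t ↔ e ∈ E ∧ ∀ u ∈ e, u ∈ t ∨ u = c := by
  simp [edgesIn]

theorem exists_chain_edges {s : List ℕ} (h : s.IsChain F.Adj) (hn : s.Nodup) :
    ∃ E : Finset (Sym2 ℕ), (∀ e ∈ E, e ∈ F.edgeSet ∧ ∀ u ∈ e, u ∈ s) ∧ s.length - 1 ≤ E.card := by
  induction s with
  | nil => exact ⟨∅, by simp, by simp⟩
  | cons a s ih =>
    cases s with
    | nil => exact ⟨∅, by simp, by simp⟩
    | cons b s =>
      rw [List.isChain_cons_cons] at h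
      rw [List.nodup_cons] at hn
      obtain ⟨E, hE, hc⟩ := ih h.2 hn.2
      refine ⟨insert s(a, b) E, fun e he => ?_, ?_⟩
      · rcases Finset.mem_insert.1 he with rfl | he
        · exact ⟨h.1, by simp⟩
        · exact ⟨(hE e he).1, fun u hu => List.mem_cons_of_mem _ ((hE e he).2 u hu)⟩
      · rw [Finset.card_insert_of_notMem fun he => hn.1 ((hE _ he).2 a (by simp))]
        simp only [List.length_cons, Nat.add_sub_cancel] at hc ⊢
        omega

/-- A nonempty list starts with a maximal chain. -/
theorem exists_maximal_chain (r : ℕ → ℕ → Prop) (t : List ℕ) (ht : t ≠ []) :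
    ∃ s t', t = s ++ t' ∧ s ≠ [] ∧ s.IsChain r ∧
      ∀ x ∈ s.getLast?, ∀ y ∈ t'.head?, ¬ r x y := by
  induction t with
  | nil => exact absurd rfl ht
  | cons a t ih =>
    cases t with
    | nil => exact ⟨[a], [], by simp⟩
    | cons b t =>
      by_cases hab : r a b
      · obtain ⟨s, t', h1, h2, h3, h4⟩ := ih (by simp)
        cases s with
        | nil => exact absurd rfl h2
        | cons b' s =>
          obtain ⟨rfl, rfl⟩ : b = b' ∧ t = s ++ t' := by simpa using h1
          exact ⟨a :: b :: s, t', by simp, by simp, List.isChain_cons_cons.2 ⟨hab, h3⟩,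
            by simpa using h4⟩
      · exact ⟨[a], b :: t, by simp, by simp, by simp, by simpa using hab⟩

/-- Here `s` carries a component of `F - c`. Either an edge of `F` joins it to `c` and pays for one
more than the edges of the path, or `s` is closed under adjacency in `F` and hence under the
terminal pairs. -/
theorem segCost_le (hM : ∀ i j, adjB M i j = true ↔ G.Adj i j) (hFG : F ≤ G)
    (hS : ∀ p ∈ S, F.Reachable p.1 p.2) {E : Finset (Sym2 ℕ)} (hE : ∀ e, e ∈ E ↔ e ∈ F.edgeSet)
    {s : List ℕ} (hne : s ≠ []) (hch : s.IsChain F.Adj) (hn : s.Nodup) (hc : c ∉ s)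
    (hcl : ∀ u ∈ s, ∀ w, F.Adj u w → w ≠ c → w ∈ s) :
    segCost M S c s ≤ (edgesIn E c s).card := by
  obtain ⟨E₀, h0, h0c⟩ := exists_chain_edges hch hn
  have hpos := List.length_pos_iff.2 hne
  by_cases hx : ∃ u ∈ s, F.Adj c u
  · obtain ⟨u, hu, hcu⟩ := hx
    have hle : segCost M S c s ≤ s.length := by
      unfold segCost
      split_ifs with h1 h2
      · omega
      · exact le_rfl
      · exact absurd (List.any_eq_true.2 ⟨u, hu, (hM _ _).2 (hFG hcu)⟩) h2
    have hnot : s(c, u) ∉ E₀ := fun h => hc ((h0 _ h).2 c (by simp))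
    have hsub : insert s(c, u) E₀ ⊆ edgesIn E c s := by
      intro e he
      rw [mem_edgesIn, hE]
      rcases Finset.mem_insert.1 he with rfl | he
      · exact ⟨hcu, by simp [hu]⟩
      · exact ⟨(h0 e he).1, fun v hv => .inl ((h0 e he).2 v hv)⟩
    have := Finset.card_le_card hsub
    rw [Finset.card_insert_of_notMem hnot] at this
    omega
  · push Not at hx
    have hcl' : ∀ u w, u ∈ s → F.Adj u w → w ∈ s := fun u w hu huw =>
      hcl u hu w huw fun h => hx u hu (h ▸ huw.symm)
    have hreach : ∀ u w, F.Reachable u w → u ∈ s → w ∈ s := by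
      rintro u w ⟨p⟩ hu
      induction p with
      | nil => exact hu
      | cons h p ih => exact ih (hcl' _ _ hu h)
    have hclosed : closedB S s = true := closedB_iff.2 fun p hp =>
      ⟨hreach _ _ (hS p hp), hreach _ _ (hS p hp).symm⟩
    rw [segCost, if_pos hclosed]
    refine h0c.trans (Finset.card_le_card fun e he => ?_)
    rw [mem_edgesIn, hE]
    exact ⟨(h0 e he).1, fun v hv => .inl ((h0 e he).2 v hv)⟩

/-- Cut `t` into maximal runs along edges of `F`. As `F`-adjacent entries are consecutive, no edge
of `F` joins two runs, so `segCost_le` applies to each. The charged edge sets are disjoint, because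
an edge has an endpoint other than `c`. -/
theorem dp_le (hM : ∀ i j, adjB M i j = true ↔ G.Adj i j) (hFG : F ≤ G)
    (hS : ∀ p ∈ S, F.Reachable p.1 p.2) {E : Finset (Sym2 ℕ)} (hE : ∀ e, e ∈ E ↔ e ∈ F.edgeSet)
    (m : ℕ) : ∀ t : List ℕ, t.length ≤ m → t.Nodup → c ∉ t →
      (∀ l₁ a l₂ b l₃, t = l₁ ++ (a :: l₂ ++ b :: l₃) → F.Adj a b → l₂ = []) →
      (∀ u ∈ t, ∀ w, F.Adj u w → w ≠ c → w ∈ t) → dp M S c t ≤ (edgesIn E c t).card := by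
  induction m with
  | zero =>
    intro t ht _ _ _ _
    obtain rfl := List.length_eq_zero_iff.1 (Nat.le_zero.1 ht)
    exact Nat.zero_le _
  | succ m ih =>
    intro t ht hn hc hcons hcl
    by_cases hne : t = []
    · subst hne
      exact Nat.zero_le _
    obtain ⟨s, t', rfl, hs, hch, hlast⟩ := exists_maximal_chain F.Adj t hne
    have hpos := List.length_pos_iff.2 hs
    rw [List.nodup_append] at hn
    simp only [List.mem_append, not_or] at hc
    have hsep : ∀ u ∈ s, ∀ w ∈ t', ¬ F.Adj u w := by
      intro u hu w hw huw
      obtain ⟨l₁, l₂, rfl⟩ := List.append_of_mem hu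
      obtain ⟨l₃, l₄, rfl⟩ := List.append_of_mem hw
      have := hcons l₁ u (l₂ ++ l₃) w l₄ (by simp) huw
      obtain ⟨rfl, rfl⟩ := List.append_eq_nil_iff.1 this
      exact hlast u (by simp) w (by simp) huw
    have hcls : ∀ u ∈ s, ∀ w, F.Adj u w → w ≠ c → w ∈ s := fun u hu w huw hwc =>
      (List.mem_append.1 (hcl u (List.mem_append_left _ hu) w huw hwc)).resolve_right
        fun hw => hsep u hu w hw huw
    have hclt : ∀ u ∈ t', ∀ w, F.Adj u w → w ≠ c → w ∈ t' := fun u hu w huw hwc =>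
      (List.mem_append.1 (hcl u (List.mem_append_right _ hu) w huw hwc)).resolve_left
        fun hw => hsep w hw u hu huw.symm
    have h1 := segCost_le hM hFG hS hE hs hch hn.1 hc.1 hcls
    have h2 := ih t' (by simp at ht; omega) hn.2.1 hc.2
      (fun l₁ a l₂ b l₃ h => hcons (s ++ l₁) a l₂ b l₃ (by rw [h, List.append_assoc])) hclt
    refine (dp_append_le M S c s t' hs).trans ((Nat.add_le_add h1 h2).trans ?_)
    have hdisj : Disjoint (edgesIn E c s) (edgesIn E c t') := by
      rw [Finset.disjoint_left]
      intro e he he'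
      simp only [mem_edgesIn] at he he'
      induction e with
      | _ x y =>
        have hxy : F.Adj x y := (hE _).1 he.1
        have h3 : ∀ z ∈ s(x, y), z = c := fun z hz => by
          rcases he.2 z hz with h | h
          · rcases he'.2 z hz with h' | h'
            · exact absurd rfl (hn.2.2 z h z h')
            · exact h'
          · exact h
        exact hxy.ne ((h3 x (by simp)).trans (h3 y (by simp)).symm)
    rw [← Finset.card_union_of_disjoint hdisj]
    refine Finset.card_le_card (Finset.union_subset ?_ ?_) <;> intro e he <;>
      simp only [mem_edgesIn, List.mem_append] at he ⊢
    · exact ⟨he.1, fun u hu => (he.2 u hu).imp_left .inl⟩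
    · exact ⟨he.1, fun u hu => (he.2 u hu).imp_left .inr⟩

/-- The algorithm finds a solution that is at most as expensive as `F`. -/
theorem total_le (hM : ∀ i j, adjB M i j = true ↔ G.Adj i j)
    (hG : ∀ i j, G.Adj i j → i < M.length) (hFG : F ≤ G) (hac : F.IsAcyclic)
    (hS : ∀ p ∈ S, F.Reachable p.1 p.2) {E : Finset (Sym2 ℕ)} (hE : ∀ e, e ∈ E ↔ e ∈ F.edgeSet)
    (hdeg : ∀ v x y z, linkB M R c v x = true → linkB M R c v y = true →
      linkB M R c v z = true → x = y ∨ x = z ∨ y = z)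
    (hFR : ∀ u v, F.Adj u v → u ≠ c → v ≠ c → linkB M R c u v = true) :
    total M S R c ≤ E.card := by
  let H : SimpleGraph ℕ :=
    { Adj := fun u v => linkB M R c u v = true
      symm := ⟨fun u v h => linkB_symm hM h⟩
      loopless := ⟨fun u h => (linkB_adj hM h).ne rfl⟩ }
  let F₀ : SimpleGraph ℕ :=
    { Adj := fun u v => F.Adj u v ∧ u ≠ c ∧ v ≠ c
      symm := ⟨fun u v h => ⟨h.1.symm, h.2.2, h.2.1⟩⟩
      loopless := ⟨fun u h => h.1.ne rfl⟩ }
  have hF₀ : F₀ ≤ F := fun u v h => h.1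
  have hF₀H : F₀ ≤ H := fun u v h => hFR u v h.1 h.2.1 h.2.2
  -- Extend `F - c` to a spanning forest `T` of `H`. Its components are paths with the same vertices
  -- as those of `H`, which cuts every cycle at an edge outside `F`.
  obtain ⟨T, h1, h2, h3, h4⟩ :=
    H.exists_isAcyclic_reachable_eq_le_of_le_of_isAcyclic hF₀H (hac.anti hF₀)
  have hTlt : ∀ u v, T.Adj u v → u < M.length := fun u v h => hG _ _ (linkB_adj hM (h2 h))
  have hex : ∀ v, v < M.length ∧ v ≠ c → ∃ L : List ℕ, isTrav M R c L = true ∧ v ∈ L ∧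
      L ∈ candidates M R c ∧ dp M S c L ≤ (edgesIn E c L).card := by
    rintro v ⟨hv, hvc⟩
    obtain ⟨L, hn, hch, hvL, hlt, hcl⟩ := exists_traversal hTlt
      (fun v x y z hx hy hz => hdeg v x y z (h2 hx) (h2 hy) (h2 hz)) hv
    have hcl' : ∀ u ∈ L, ∀ w, H.Reachable u w → w ∈ L := by
      intro u hu w huw
      rw [← h4] at huw
      obtain ⟨p⟩ := huw
      induction p with
      | nil => exact hu
      | cons h p ih => exact ih (hcl _ hu _ h)
    have hchH : L.IsChain fun u v => linkB M R c u v = true := hch.imp fun _ _ h => h2 h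
    have hcL : c ∉ L := by
      intro hc
      -- `c` is isolated in `T`, so a chain through `c` contains nothing else.
      have : ∀ u ∈ L, u = c := IsChain.subset_of_closed (fun _ _ h => h.symm) hch
        (fun u w hu huw => absurd hu (linkB_iff.1 (h2 huw)).2.1) hc rfl
      exact hvc (this v hvL)
    have htrav : isTrav M R c L = true :=
      isTrav_iff.2 ⟨hchH, hcL, fun u hu w _ h => hcl' u hu w (Adj.reachable (G := H) h)⟩
    refine ⟨L, htrav, hvL, mem_candidates (List.ne_nil_of_mem hvL) hn hchH
      (fun _ _ h => linkB_symm hM h) hlt hdeg, dp_le hM hFG hS hE _ L le_rfl hn hcL ?_ ?_⟩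
    · rintro l₁ a l₂ b l₃ rfl hab
      exact eq_nil_of_adj h3 hch hn (h1 ⟨hab, fun h => hcL (h ▸ by simp), fun h => hcL (h ▸ by simp)⟩)
    · exact fun u hu w huw hwc => hcl u hu w (h1 ⟨huw, fun h => hcL (h ▸ hu), hwc⟩)
  choose! L hL1 hL2 hL3 hL4 using hex
  let D : ℕ → Finset (Sym2 ℕ) := fun v =>
    if (v < M.length ∧ v ≠ c) ∧ ∀ u ∈ L v, v ≤ u then edgesIn E c (L v) else ∅
  have hcost : ∀ v ∈ Finset.range M.length, (if v = c then 0 else cost M S R c v) ≤ (D v).card := by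
    intro v hv
    rw [Finset.mem_range] at hv
    split_ifs with hvc
    · exact Nat.zero_le _
    refine (foldl_min_le_of_mem (List.mem_map.2 ⟨L v, List.mem_filter.2 ⟨hL3 v ⟨hv, hvc⟩, ?_⟩, rfl⟩)
      _).trans ?_
    · rw [Bool.and_eq_true, List.contains_iff_mem]
      exact ⟨hL1 v ⟨hv, hvc⟩, hL2 v ⟨hv, hvc⟩⟩
    · split_ifs with hmin
      · have : D v = edgesIn E c (L v) := if_pos ⟨⟨hv, hvc⟩, by simpa using hmin⟩
        rw [this]
        exact hL4 v ⟨hv, hvc⟩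
      · exact Nat.zero_le _
  rw [total_eq]
  refine (Finset.sum_le_sum hcost).trans ?_
  rw [← Finset.card_biUnion]
  · refine Finset.card_le_card (Finset.biUnion_subset.2 fun v _ => ?_)
    simp only [D]
    split_ifs
    · exact fun e he => (mem_edgesIn.1 he).1
    · simp
  -- A common edge has an endpoint other than `c`, which lies in both traversals; they then have the
  -- same vertices, and `v`, `v'` are both the smallest one.
  · intro v _ v' _ hne
    change Disjoint (D v) (D v')
    rw [Finset.disjoint_left]
    intro e he he'
    simp only [D] at he he'
    split_ifs at he he' with hv hv'
    · simp only [mem_edgesIn] at he he'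
      induction e with
      | _ x y =>
        have hxy : F.Adj x y := (hE _).1 he.1
        obtain ⟨z, hz, hzc⟩ : ∃ z ∈ s(x, y), z ≠ c := by
          by_cases hx : x = c
          · exact ⟨y, by simp, fun h => hxy.ne (hx.trans h.symm)⟩
          · exact ⟨x, by simp, hx⟩
        have hz1 := (he.2 z hz).resolve_right hzc
        have hz2 := (he'.2 z hz).resolve_right hzc
        have hs := subset_of_isTrav hM hG (hL1 v hv.1) (hL1 v' hv'.1) hz1 hz2
        have hs' := subset_of_isTrav hM hG (hL1 v' hv'.1) (hL1 v hv.1) hz2 hz1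
        exact hne (le_antisymm (hv.2 v' (hs' (hL2 v' hv'.1))) (hv'.2 v (hs (hL2 v hv.1))))
    all_goals simp at he he'

end Charging

end SteinerForest

namespace SteinerForest

open SimpleGraph

/-! ### The Helly property of claws in a forest -/

section Claws

variable {V : Type*} {G F : SimpleGraph V}

/-- `x` is adjacent to the distinct vertices `a`, `b`, `d`. -/
def IsClaw (G : SimpleGraph V) (x a b d : V) : Prop :=
  G.Adj x a ∧ G.Adj x b ∧ G.Adj x d ∧ a ≠ b ∧ a ≠ d ∧ b ≠ d

/-- Any two claws of `G` share a vertex. -/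
def ClawsMeet (G : SimpleGraph V) : Prop :=
  ∀ x a b d y a' b' d', IsClaw G x a b d → IsClaw G y a' b' d' →
    ∃ z, z ∈ [x, a, b, d] ∧ z ∈ [y, a', b', d']

theorem IsClaw.mono (h : F ≤ G) {x a b d : V} (hc : IsClaw F x a b d) : IsClaw G x a b d :=
  ⟨h hc.1, h hc.2.1, h hc.2.2.1, hc.2.2.2⟩

theorem ClawsMeet.mono (h : F ≤ G) (hG : ClawsMeet G) : ClawsMeet F :=
  fun x a b d y a' b' d' h1 h2 => hG x a b d y a' b' d' (h1.mono h) (h2.mono h)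

/-- The depth of a vertex in a forest whose components are rooted arbitrarily. -/
noncomputable def depth (F : SimpleGraph V) (v : V) : ℕ :=
  F.dist (F.connectedComponentMk v).out v

theorem reachable_root (v : V) : F.Reachable (F.connectedComponentMk v).out v :=
  ConnectedComponent.exact (Quot.out_eq _)

theorem depth_of_adj (hF : F.IsAcyclic) {v w : V} (h : F.Adj v w) :
    depth F v = depth F w + 1 ∨ depth F w = depth F v + 1 := by
  have e : F.connectedComponentMk v = F.connectedComponentMk w :=
    ConnectedComponent.sound h.reachable
  unfold depth
  rw [← e]
  exact hF.dist_eq_dist_add_one_of_adj_of_reachable _ h (reachable_root v)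

/-- Every neighbour closer to the root is the penultimate vertex of one fixed shortest path `q` from
the root: a shortest path to such a neighbour is too short to pass through `v`, so by acyclicity the
neighbour lies on `q`. -/
theorem parent_unique (hF : F.IsAcyclic) {v w w' : V} (h : F.Adj v w) (h' : F.Adj v w')
    (hd : depth F v = depth F w + 1) (hd' : depth F v = depth F w' + 1) : w = w' := by
  classical
  obtain ⟨q, hq, hql⟩ := (reachable_root (F := F) v).exists_path_of_dist
  have key : ∀ u, F.Adj v u → depth F v = depth F u + 1 → u = q.penultimate := by
    intro u hu hdu
    have e : F.connectedComponentMk v = F.connectedComponentMk u :=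
      ConnectedComponent.sound hu.reachable
    unfold depth at hdu
    rw [← e] at hdu
    obtain ⟨p, hp, hpl⟩ := ((reachable_root (F := F) v).trans hu.reachable).exists_path_of_dist
    refine hF.eq_penultimate_of_adj_end hq hu
      (hF.mem_support_of_ne_mem_support_of_adj_of_isPath hq hp hu fun hv => ?_)
    have h1 := dist_le (p.takeUntil v hv)
    have h2 := p.length_takeUntil_le_length hv
    omega
  rw [key w h hd, key w' h' hd']

/-- `t` is the vertex of least depth in the connected set `T`. -/
def IsTop (F : SimpleGraph V) (T : List V) (t : V) : Prop :=
  t ∈ T ∧ ∀ y ∈ T, y = t ∨ ∃ z ∈ T, F.Adj y z ∧ depth F y = depth F z + 1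

theorem IsTop.depth_lt {T : List V} {t : V} (h : IsTop F T t) (n : ℕ) :
    ∀ y ∈ T, depth F y ≤ n → y = t ∨ depth F t < depth F y := by
  induction n with
  | zero =>
    intro y hy hn
    rcases h.2 y hy with h' | ⟨z, -, -, hz⟩
    · exact .inl h'
    · omega
  | succ n ih =>
    intro y hy hn
    rcases h.2 y hy with h' | ⟨z, hz, -, hz'⟩
    · exact .inl h'
    · rcases ih z hz (by omega) with rfl | h'
      · right; omega
      · right; omega

/-- The top of the deeper one of two connected sets that meet belongs to both. -/
theorem IsTop.mem_of_meet (hF : F.IsAcyclic) {T T' : List V} {t t' : V} (h : IsTop F T t)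
    (h' : IsTop F T' t') (hle : depth F t' ≤ depth F t) (n : ℕ) :
    ∀ y ∈ T, y ∈ T' → depth F y ≤ n → t ∈ T' := by
  induction n with
  | zero =>
    intro y hy hy' hn
    rcases h.2 y hy with rfl | ⟨z, -, -, hz⟩
    · exact hy'
    · omega
  | succ n ih =>
    intro y hy hy' hn
    rcases h.2 y hy with rfl | ⟨z, hz, hyz, hdz⟩
    · exact hy'
    -- Climb from the common vertex to its parent, which lies in both sets by uniqueness. The climb
    -- cannot reach `t'` strictly before `t`, as `t'` is not deeper than `t`.
    rcases h'.2 y hy' with rfl | ⟨z', hz', hyz', hdz'⟩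
    · rcases h.depth_lt _ y hy le_rfl with rfl | hlt
      · exact hy'
      · omega
    · obtain rfl := parent_unique hF hyz hyz' hdz hdz'
      exact ih z hz hz' (by omega)

/-- At most one leaf is the parent of the centre `x`. If there is one, it is the top; otherwise `x`
is. -/
theorem IsClaw.exists_top (hF : F.IsAcyclic) {x a b d : V} (h : IsClaw F x a b d) :
    ∃ t, IsTop F [x, a, b, d] t := by
  obtain ⟨ha, hb, hd, hab, had, hbd⟩ := h
  have key : ∀ u w, F.Adj x u → F.Adj x w → u ≠ w → depth F x = depth F u + 1 →
      depth F w = depth F x + 1 := by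
    intro u w hu hw huw hxu
    rcases depth_of_adj hF hw with h | h
    · exact absurd (parent_unique hF hu hw hxu h) huw
    · exact h
  have child : ∀ w, F.Adj x w → depth F w = depth F x + 1 →
      ∃ z ∈ [x, a, b, d], F.Adj w z ∧ depth F w = depth F z + 1 :=
    fun w hw h => ⟨x, by simp, hw.symm, h⟩
  by_cases h1 : depth F x = depth F a + 1
  · refine ⟨a, by simp, ?_⟩
    simp only [List.forall_mem_cons]
    exact ⟨.inr ⟨a, by simp, ha, h1⟩, .inl trivial, .inr (child b hb (key a b ha hb hab h1)),
      .inr (child d hd (key a d ha hd had h1)), by simp⟩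
  by_cases h2 : depth F x = depth F b + 1
  · refine ⟨b, by simp, ?_⟩
    simp only [List.forall_mem_cons]
    exact ⟨.inr ⟨b, by simp, hb, h2⟩, .inr (child a ha (key b a hb ha hab.symm h2)), .inl trivial,
      .inr (child d hd (key b d hb hd hbd h2)), by simp⟩
  by_cases h3 : depth F x = depth F d + 1
  · refine ⟨d, by simp, ?_⟩
    simp only [List.forall_mem_cons]
    exact ⟨.inr ⟨d, by simp, hd, h3⟩, .inr (child a ha (key d a hd ha had.symm h3)),
      .inr (child b hb (key d b hd hb hbd.symm h3)), .inl trivial, by simp⟩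
  · refine ⟨x, by simp, ?_⟩
    simp only [List.forall_mem_cons]
    exact ⟨.inl trivial, .inr (child a ha ((depth_of_adj hF ha).resolve_left h1)),
      .inr (child b hb ((depth_of_adj hF hb).resolve_left h2)),
      .inr (child d hd ((depth_of_adj hF hd).resolve_left h3)), by simp⟩

/-- Helly property: if the claws of a finite forest meet pairwise, they have a common vertex. -/
theorem exists_common_vertex (hF : F.IsAcyclic) (hfin : {v | ∃ w, F.Adj v w}.Finite)
    (hmeet : ClawsMeet F) {x a b d : V} (h : IsClaw F x a b d) :
    ∃ c, (∃ w, F.Adj c w) ∧ ∀ x a b d, IsClaw F x a b d → c ∈ [x, a, b, d] := by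
  let tops : Set V := {t | ∃ x a b d, IsClaw F x a b d ∧ IsTop F [x, a, b, d] t}
  have hsub : tops ⊆ {v | ∃ w, F.Adj v w} := by
    rintro t ⟨x, a, b, d, hc, ht, -⟩
    simp only [List.mem_cons, List.not_mem_nil, or_false] at ht
    rcases ht with rfl | rfl | rfl | rfl
    · exact ⟨a, hc.1⟩
    · exact ⟨x, hc.1.symm⟩
    · exact ⟨x, hc.2.1.symm⟩
    · exact ⟨x, hc.2.2.1.symm⟩
  have hne : tops.Nonempty := by
    obtain ⟨t, ht⟩ := h.exists_top hF
    exact ⟨t, x, a, b, d, h, ht⟩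
  -- A deepest top lies in every claw, since its own claw meets each of them.
  obtain ⟨c, hc, hmax⟩ := Set.exists_max_image tops (depth F) (hfin.subset hsub) hne
  refine ⟨c, hsub hc, fun x' a' b' d' h' => ?_⟩
  obtain ⟨x, a, b, d, h1, h2⟩ := hc
  obtain ⟨t', ht'⟩ := h'.exists_top hF
  obtain ⟨y, hy, hy'⟩ := hmeet _ _ _ _ _ _ _ _ h1 h'
  exact h2.mem_of_meet hF ht' (hmax t' ⟨x', a', b', d', h', ht'⟩) _ y hy hy' le_rfl

theorem clawsMeet_of_free (h : twoClaws.Free G) : ClawsMeet G := by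
  intro x a b d y a' b' d' h1 h2
  by_contra hcon
  push Not at hcon
  simp only [List.mem_cons, List.not_mem_nil, or_false, not_or, forall_eq_or_imp, forall_eq]
    at hcon
  obtain ⟨⟨q1, q2, q3, q4⟩, ⟨q5, q6, q7, q8⟩, ⟨q9, q10, q11, q12⟩, q13, q14, q15, q16⟩ := hcon
  obtain ⟨h11, h12, h13, h14, h15, h16⟩ := h1
  obtain ⟨h21, h22, h23, h24, h25, h26⟩ := h2
  refine h ⟨⟨⟨Sum.elim (Sum.elim (fun _ => x) ![a, b, d]) (Sum.elim (fun _ => y) ![a', b', d']),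
    ?_⟩, ?_⟩⟩
  · rintro ((i | i) | (i | i)) ((j | j) | (j | j)) hij <;>
      simp at hij
    · fin_cases j <;> simpa
    · fin_cases i <;> simpa using by first | exact h11.symm | exact h12.symm | exact h13.symm
    · fin_cases j <;> simpa
    · fin_cases i <;> simpa using by first | exact h21.symm | exact h22.symm | exact h23.symm
  · have n1 := h11.ne
    have n2 := h12.ne
    have n3 := h13.ne
    have n4 := h21.ne
    have n5 := h22.ne
    have n6 := h23.ne
    rintro ((i | i) | (i | i)) ((j | j) | (j | j)) hij <;>
      fin_cases i <;> fin_cases j <;> simp_all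

end Claws

end SteinerForest

namespace SteinerForest

open SimpleGraph

/-! ### Reduction to maximum degree two -/

section Apex

variable {n : ℕ} {G F : SimpleGraph ℕ}

/-- After the deletion of a vertex `c` and of the edges in `R`, all degrees are at most two. -/
def Thin (G : SimpleGraph ℕ) (c : ℕ) (R : List (ℕ × ℕ)) : Prop :=
  ∀ v x y z, G.Adj v x ∧ v ≠ c ∧ x ≠ c ∧ (v, x) ∉ R ∧ (x, v) ∉ R →
    G.Adj v y ∧ v ≠ c ∧ y ≠ c ∧ (v, y) ∉ R ∧ (y, v) ∉ R →
    G.Adj v z ∧ v ≠ c ∧ z ≠ c ∧ (v, z) ∉ R ∧ (z, v) ∉ R → x = y ∨ x = z ∨ y = z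

open Classical in
/-- The neighbours of a vertex of a graph on the numbers below `n`. -/
noncomputable def nbrs (n : ℕ) (G : SimpleGraph ℕ) (v : ℕ) : Finset ℕ :=
  (Finset.range n).filter fun w => G.Adj v w

theorem mem_nbrs (hG : ∀ i j, G.Adj i j → i < n) {v w : ℕ} : w ∈ nbrs n G v ↔ G.Adj v w := by
  simp only [nbrs, Finset.mem_filter, Finset.mem_range, and_iff_right_iff_imp]
  exact fun h => hG _ _ h.symm

/-- A vertex of large degree meets all claws. -/
theorem thin_of_large_degree (hG : ∀ i j, G.Adj i j → i < n) (hmeet : ClawsMeet G) {c : ℕ}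
    (hc : 7 ≤ (nbrs n G c).card) : Thin G c [] := by
  rintro v x y z ⟨hx, hvc, hxc, -⟩ ⟨hy, -, hyc, -⟩ ⟨hz, -, hzc, -⟩
  by_contra hne
  simp only [not_or] at hne
  -- Of the seven neighbours of `c`, at least three avoid the claw `v, x, y, z`, and form with `c` a
  -- claw disjoint from it.
  have h1 : 2 < (nbrs n G c \ {v, x, y, z}).card := by
    have h2 := Finset.le_card_sdiff {v, x, y, z} (nbrs n G c)
    have h3 : ({v, x, y, z} : Finset ℕ).card ≤ 4 := Finset.card_le_four
    omega
  obtain ⟨a, ha, b, hb, d, hd, hab, had, hbd⟩ := Finset.two_lt_card.1 h1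
  simp only [Finset.mem_sdiff, mem_nbrs hG, Finset.mem_insert, Finset.mem_singleton,
    not_or] at ha hb hd
  obtain ⟨w, hw, hw'⟩ := hmeet v x y z c a b d ⟨hx, hy, hz, hne.1, hne.2.1, hne.2.2⟩
    ⟨ha.1, hb.1, hd.1, hab, had, hbd⟩
  simp only [List.mem_cons, List.not_mem_nil, or_false] at hw hw'
  grind

open Classical in
/-- The vertices of degree at least three. -/
noncomputable def branch (n : ℕ) (G : SimpleGraph ℕ) : Finset ℕ :=
  (Finset.range n).filter fun v => ∃ a b d, IsClaw G v a b d

theorem mem_branch (hG : ∀ i j, G.Adj i j → i < n) {v : ℕ} :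
    v ∈ branch n G ↔ ∃ a b d, IsClaw G v a b d := by
  simp only [branch, Finset.mem_filter, Finset.mem_range, and_iff_right_iff_imp]
  rintro ⟨a, -, -, h, -⟩
  exact hG _ _ h

/-- Fix one claw. Any other one meets it, so its centre belongs to the fixed claw or is adjacent to
it: 4 + 4 · 6 vertices. -/
theorem card_branch_le (hG : ∀ i j, G.Adj i j → i < n) (hmeet : ClawsMeet G)
    (hdeg : ∀ v, (nbrs n G v).card ≤ 6) : (branch n G).card ≤ 28 := by
  rcases (branch n G).eq_empty_or_nonempty with h | ⟨x, hx⟩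
  · simp [h]
  obtain ⟨a, b, d, hc⟩ := (mem_branch hG).1 hx
  have hsub : branch n G ⊆ ({x, a, b, d} : Finset ℕ) ∪
      ({x, a, b, d} : Finset ℕ).biUnion (nbrs n G) := by
    intro v hv
    obtain ⟨a', b', d', hv⟩ := (mem_branch hG).1 hv
    obtain ⟨w, hw, hw'⟩ := hmeet _ _ _ _ _ _ _ _ hc hv
    rw [Finset.mem_union, Finset.mem_biUnion]
    have hwK : w ∈ ({x, a, b, d} : Finset ℕ) := by simpa using hw
    simp only [List.mem_cons, List.not_mem_nil, or_false] at hw'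
    obtain ⟨h1, h2, h3, -⟩ := hv
    rcases hw' with rfl | rfl | rfl | rfl
    · exact .inl hwK
    · exact .inr ⟨_, hwK, (mem_nbrs hG).2 h1.symm⟩
    · exact .inr ⟨_, hwK, (mem_nbrs hG).2 h2.symm⟩
    · exact .inr ⟨_, hwK, (mem_nbrs hG).2 h3.symm⟩
  have h4 : ({x, a, b, d} : Finset ℕ).card ≤ 4 := Finset.card_le_four
  have h5 := Finset.card_biUnion_le_card_mul ({x, a, b, d} : Finset ℕ) (nbrs n G) 6
    fun v _ => hdeg v
  have := (Finset.card_le_card hsub).trans (Finset.card_union_le _ _)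
  omega

/-- A graph in which the claws meet is thin up to a vertex and a bounded number of edges that do
not belong to a given forest. -/
theorem exists_thin (hG : ∀ i j, G.Adj i j → i < n) (hmeet : ClawsMeet G) (hFG : F ≤ G)
    (hF : F.IsAcyclic) :
    ∃ (R : List (ℕ × ℕ)) (c : ℕ), R.length ≤ 168 ∧ (∀ p ∈ R, p.1 < n ∧ p.2 < n) ∧ c ≤ n ∧
      (∀ u v, F.Adj u v → (u, v) ∉ R) ∧ Thin G c R := by
  classical
  by_cases hdeg : ∃ c, 7 ≤ (nbrs n G c).card
  · obtain ⟨c, hc⟩ := hdeg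
    refine ⟨[], c, by simp, by simp, ?_, by simp, thin_of_large_degree hG hmeet hc⟩
    obtain ⟨w, hw⟩ := Finset.card_pos.1 (by omega : 0 < (nbrs n G c).card)
    exact (hG _ _ ((mem_nbrs hG).1 hw)).le
  push Not at hdeg
  obtain ⟨c, hcn, hc⟩ : ∃ c ≤ n, ∀ x a b d, IsClaw F x a b d → c ∈ [x, a, b, d] := by
    by_cases h : ∃ x a b d, IsClaw F x a b d
    · obtain ⟨x, a, b, d, h⟩ := h
      have hfin : {v | ∃ w, F.Adj v w}.Finite :=
        (Set.finite_lt_nat n).subset fun v ⟨w, hw⟩ => hG _ _ (hFG hw)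
      obtain ⟨c, ⟨w, hw⟩, hc⟩ := exists_common_vertex hF hfin (hmeet.mono hFG) h
      exact ⟨c, (hG _ _ (hFG hw)).le, hc⟩
    -- If `F` has no claw, no vertex need be deleted, and the non-vertex `n` stands in.
    · exact ⟨n, le_rfl, fun x a b d h' => absurd ⟨x, a, b, d, h'⟩ h⟩
  let R : Finset (ℕ × ℕ) := (branch n G).biUnion fun b =>
    ((nbrs n G b).filter fun w => ¬ F.Adj b w).image fun w => (b, w)
  have hR : ∀ b w, (b, w) ∈ R ↔ b ∈ branch n G ∧ G.Adj b w ∧ ¬ F.Adj b w := by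
    intro b w
    simp only [R, Finset.mem_biUnion, Finset.mem_image, Finset.mem_filter, mem_nbrs hG,
      Prod.mk.injEq]
    constructor
    · rintro ⟨b, hb, w, hw, rfl, rfl⟩
      exact ⟨hb, hw⟩
    · rintro ⟨hb, hw⟩
      exact ⟨b, hb, w, hw, rfl, rfl⟩
  refine ⟨R.toList, c, ?_, fun ⟨b, w⟩ hp => ?_, hcn, fun u v huv => ?_, ?_⟩
  · rw [Finset.length_toList]
    refine (Finset.card_biUnion_le_card_mul _ _ 6 fun b _ => ?_).trans
      (Nat.mul_le_mul_right 6 (card_branch_le hG hmeet fun v => Nat.le_of_lt_succ (hdeg v)))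
    exact Finset.card_image_le.trans
      ((Finset.card_filter_le _ _).trans (Nat.le_of_lt_succ (hdeg b)))
  · rw [Finset.mem_toList, hR] at hp
    exact ⟨hG _ _ hp.2.1, hG _ _ hp.2.1.symm⟩
  · rw [Finset.mem_toList, hR]
    exact fun h => h.2.2 huv
  -- A vertex with three surviving neighbours is a branch vertex, so its surviving edges belong to
  -- `F` and form a claw of `F` that avoids `c`.
  · rintro v x y z ⟨hx, hvc, hxc, hx', -⟩ ⟨hy, -, hyc, hy', -⟩ ⟨hz, -, hzc, hz', -⟩
    by_contra hne
    simp only [not_or] at hne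
    have hv : v ∈ branch n G := (mem_branch hG).2 ⟨x, y, z, hx, hy, hz, hne⟩
    rw [Finset.mem_toList, hR] at hx' hy' hz'
    have hFx : F.Adj v x := by tauto
    have hFy : F.Adj v y := by tauto
    have hFz : F.Adj v z := by tauto
    have := hc v x y z ⟨hFx, hFy, hFz, hne⟩
    simp only [List.mem_cons, List.not_mem_nil, or_false] at this
    grind

end Apex

/-! ### Enumerating the guesses, and correctness of the procedure -/

section Enumeration

theorem mem_tuples {α : Type} {l : List α} {r : ℕ} {t : List α} :
    t ∈ tuples r l ↔ t.length = r ∧ ∀ x ∈ t, x ∈ l := by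
  induction r generalizing t with
  | zero =>
    simp only [tuples, List.mem_singleton, List.length_eq_zero_iff]
    constructor
    · rintro rfl; simp
    · exact fun h => h.1
  | succ r ih =>
    simp only [tuples, List.mem_flatMap, List.mem_map, ih]
    cases t with
    | nil => simp
    | cons y t => simp; tauto

theorem mem_allPairs {m : ℕ} {p : ℕ × ℕ} : p ∈ allPairs m ↔ p.1 < m ∧ p.2 < m := by
  obtain ⟨i, j⟩ := p
  simp [allPairs]

theorem capped_bits (m k : ℕ) : capped m k.bits = min m k := by
  induction k using Nat.strong_induction_on with
  | _ k ih =>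
    rcases Nat.eq_zero_or_pos k with rfl | hk
    · simp [capped]
    · obtain ⟨j, rfl | rfl⟩ := k.even_or_odd'
      · have := ih j (by omega)
        rw [Nat.bit0_bits _ (by omega)]
        simp only [capped, List.foldr_cons] at this ⊢
        rw [this]
        simp
        omega
      · have := ih j (by omega)
        rw [Nat.bit1_bits]
        simp only [capped, List.foldr_cons] at this ⊢
        rw [this]
        simp
        omega

end Enumeration

/-- The decision procedure is correct on graphs in which the claws meet. -/
theorem solve_iff {M : List (List Bool)} {S : List (ℕ × ℕ)} {k : ℕ} {G : SimpleGraph ℕ}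
    (hM : ∀ i j, adjB M i j = true ↔ G.Adj i j) (hG : ∀ i j, G.Adj i j → i < M.length)
    (hS : ∀ p ∈ S, p.1 < M.length ∧ p.2 < M.length) (hmeet : ClawsMeet G) :
    solve 168 (M, S, k.bits, ()) = true ↔ ∃ E : Finset (Sym2 ℕ),
      (E : Set (Sym2 ℕ)) ⊆ G.edgeSet ∧ E.card ≤ k ∧ ∀ p ∈ S, (ofEdges E).Reachable p.1 p.2 := by
  simp only [solve, List.any_eq_true, decide_eq_true_eq, capped_bits, List.mem_range, mem_tuples]
  constructor
  · rintro ⟨R, -, c, -, h⟩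
    -- The cap `n * n` lies below `infCost M`, so an accepted total is finite.
    obtain ⟨E, h1, h2, h3⟩ := exists_forest_of_total_le hM hG hS (R := R) (c := c)
      (lt_of_le_of_lt (h.trans (min_le_left _ _)) (Nat.lt_succ_self _))
    exact ⟨E, h1, h2.trans (h.trans (min_le_right _ _)), h3⟩
  · rintro ⟨E, h1, h2, h3⟩
    classical
    obtain ⟨F, hFE, hF, hreach⟩ := (ofEdges E).exists_isAcyclic_reachable_eq_le
    have hFG : F ≤ G := hFE.trans ((fromEdgeSet_mono h1).trans (fromEdgeSet_edgeSet G).le)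
    have hFE' : F.edgeSet ⊆ E := fun e he => by
      have := edgeSet_mono hFE he
      rw [edgeSet_fromEdgeSet] at this
      exact this.1
    let E' : Finset (Sym2 ℕ) := E.filter fun e => e ∈ F.edgeSet
    have hE' : ∀ e, e ∈ E' ↔ e ∈ F.edgeSet := fun e => by
      rw [Finset.mem_filter, and_iff_right_iff_imp]
      exact fun he => hFE' he
    obtain ⟨R, c, hR, hRn, hc, hFR, hthin⟩ := exists_thin hG hmeet hFG hF
    set n := M.length with hn
    -- Pad `R` to length 168 with the loop `(n, n)`, which is never an edge.
    let R' := R ++ List.replicate (168 - R.length) (n, n)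
    have hR' : ∀ u v, G.Adj u v → ((u, v) ∈ R' ↔ (u, v) ∈ R) := by
      intro u v huv
      simp only [R', List.mem_append, List.mem_replicate, or_iff_left_iff_imp, Prod.mk.injEq]
      rintro ⟨-, rfl, rfl⟩
      exact absurd rfl huv.ne
    have hlink : ∀ u v, linkB M R' c u v = true ↔
        G.Adj u v ∧ u ≠ c ∧ v ≠ c ∧ (u, v) ∉ R ∧ (v, u) ∉ R := by
      intro u v
      rw [linkB_iff, hM]
      refine and_congr_right fun huv => ?_
      rw [hR' _ _ huv, hR' _ _ huv.symm]
    refine ⟨R', ⟨?_, fun p hp => ?_⟩, c, by omega, ?_⟩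
    · simp only [R', List.length_append, List.length_replicate]
      omega
    · rw [mem_allPairs]
      rcases List.mem_append.1 hp with hp | hp
      · have := hRn p hp
        omega
      · obtain ⟨-, rfl⟩ := List.mem_replicate.1 hp
        exact ⟨Nat.lt_succ_self _, Nat.lt_succ_self _⟩
    · have hle : total M S R' c ≤ E'.card := by
        refine total_le hM hG hFG hF (fun p hp => ?_) hE' ?_ ?_
        · rw [hreach]
          exact h3 p hp
        · intro v x y z hx hy hz
          rw [hlink] at hx hy hz
          exact hthin v x y z hx hy hz
        · intro u v huv hu hv
          rw [hlink]
          exact ⟨hFG huv, hu, hv, hFR _ _ huv, hFR _ _ huv.symm⟩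
      refine le_min (hle.trans ?_) (hle.trans ((Finset.card_filter_le _ _).trans h2))
      -- A forest on `n` vertices has at most `n * n` edges in any case, so capping the budget does
      -- no harm.
      have hsub : E' ⊆ (Finset.range n ×ˢ Finset.range n).image fun p => s(p.1, p.2) := by
        intro e he
        rw [hE'] at he
        induction e with
        | _ x y =>
          have hxy : G.Adj x y := hFG he
          exact Finset.mem_image.2 ⟨(x, y), by simp [hG _ _ hxy, hG _ _ hxy.symm], rfl⟩
      simpa using (Finset.card_le_card hsub).trans Finset.card_image_le

/-! ### From instances on `Fin n` to graphs on the natural numbers -/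

section Instances

variable (I : SteinerInstance)

/-- The graph of an instance as a graph on the natural numbers. -/
def natGraph : SimpleGraph ℕ where
  Adj i j := ∃ (hi : i < I.n) (hj : j < I.n), I.graph.Adj ⟨i, hi⟩ ⟨j, hj⟩
  symm := ⟨fun _ _ ⟨hi, hj, h⟩ => ⟨hj, hi, h.symm⟩⟩
  loopless := ⟨fun _ ⟨_, _, h⟩ => h.ne rfl⟩

/-- The terminal pairs of an instance as pairs of natural numbers. -/
def natPairs : List (ℕ × ℕ) := I.pairs.map fun p => ((p.1 : ℕ), (p.2 : ℕ))

theorem natGraph_adj {i j : ℕ} :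
    (natGraph I).Adj i j ↔ ∃ (hi : i < I.n) (hj : j < I.n), I.graph.Adj ⟨i, hi⟩ ⟨j, hj⟩ := Iff.rfl

theorem length_adjMatrixRows : I.adjMatrixRows.length = I.n := by
  simp [SteinerInstance.adjMatrixRows]

theorem adjB_ofFn {n : ℕ} (f : Fin n → Fin n → Bool) (i j : ℕ) :
    adjB (List.ofFn fun i => List.ofFn fun j => f i j) i j = true ↔
      ∃ (hi : i < n) (hj : j < n), f ⟨i, hi⟩ ⟨j, hj⟩ = true := by
  by_cases hi : i < n <;> by_cases hj : j < n <;> simp [adjB, hi, hj]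

theorem adjB_adjMatrixRows (i j : ℕ) :
    adjB I.adjMatrixRows i j = true ↔ (natGraph I).Adj i j := by
  rw [natGraph_adj, SteinerInstance.adjMatrixRows, adjB_ofFn]
  simp only [decide_eq_true_eq]

theorem clawsMeet_natGraph (h : twoClaws.Free I.graph) : ClawsMeet (natGraph I) := by
  rintro x a b d y a' b' d' ⟨h1, h2, h3, h4, h5, h6⟩ ⟨k1, k2, k3, k4, k5, k6⟩
  rw [natGraph_adj] at h1 h2 h3 k1 k2 k3
  obtain ⟨hx, ha, h1⟩ := h1
  obtain ⟨_, hb, h2⟩ := h2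
  obtain ⟨_, hd, h3⟩ := h3
  obtain ⟨hy, ha', k1⟩ := k1
  obtain ⟨_, hb', k2⟩ := k2
  obtain ⟨_, hd', k3⟩ := k3
  obtain ⟨z, hz, hz'⟩ := clawsMeet_of_free h ⟨x, hx⟩ ⟨a, ha⟩ ⟨b, hb⟩ ⟨d, hd⟩ ⟨y, hy⟩ ⟨a', ha'⟩
    ⟨b', hb'⟩ ⟨d', hd'⟩ ⟨h1, h2, h3, by simpa, by simpa, by simpa⟩
    ⟨k1, k2, k3, by simpa, by simpa, by simpa⟩
  exact ⟨z, by simpa [Fin.ext_iff] using hz, by simpa [Fin.ext_iff] using hz'⟩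

/-- Only the edges of a subgraph matter. In the converse direction all of `Fin I.n` is taken as
vertex set, so terminals without edges are present. -/
theorem isYes_iff : I.IsYes ↔ ∃ E : Finset (Sym2 ℕ), (E : Set (Sym2 ℕ)) ⊆ (natGraph I).edgeSet ∧
    E.card ≤ I.k ∧ ∀ p ∈ natPairs I, (ofEdges E).Reachable p.1 p.2 := by
  classical
  constructor
  · rintro ⟨F, hF, hk⟩
    have hfin : F.edgeSet.Finite := Set.toFinite _
    refine ⟨hfin.toFinset.image (Sym2.map Fin.val), ?_, ?_, ?_⟩
    · intro e he
      simp only [Finset.coe_image, Set.Finite.coe_toFinset, Set.mem_image] at he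
      obtain ⟨e, he, rfl⟩ := he
      induction e with
      | _ x y => exact (natGraph_adj I).2 ⟨x.2, y.2, F.adj_sub he⟩
    · refine Finset.card_image_le.trans ?_
      rwa [← Set.ncard_eq_toFinset_card _ hfin]
    · intro p hp
      obtain ⟨q, hq, rfl⟩ := List.mem_map.1 hp
      obtain ⟨hs, ht, hr⟩ := hF q hq
      let f : F.coe →g ofEdges (hfin.toFinset.image (Sym2.map Fin.val)) :=
        ⟨fun v => (v.1 : ℕ), fun {u v} huv => by
          have huv' : F.Adj u.1 v.1 := huv
          rw [fromEdgeSet_adj]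
          refine ⟨?_, fun h => huv'.ne (Fin.ext h)⟩
          rw [Finset.mem_coe, Finset.mem_image]
          exact ⟨s(u.1, v.1), by simpa using huv', rfl⟩⟩
      exact hr.map f
  · rintro ⟨E, hE, hk, hS⟩
    let F₀ : SimpleGraph (Fin I.n) := (ofEdges E).comap Fin.val
    have hadj : ∀ {x y : ℕ}, (ofEdges E).Adj x y → (natGraph I).Adj x y := fun h =>
      hE ((fromEdgeSet_adj _).1 h).1
    have hF₀ : F₀ ≤ I.graph := fun u v h => ((natGraph_adj I).1 (hadj h)).2.2
    -- Every edge of `E` has both ends below `I.n`, so a walk that starts there stays there.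
    have key : ∀ {x y : ℕ} (_ : (ofEdges E).Walk x y) (hx : x < I.n),
        ∃ hy : y < I.n, F₀.Reachable ⟨x, hx⟩ ⟨y, hy⟩ := by
      intro x y p
      induction p with
      | nil => exact fun hx => ⟨hx, Reachable.rfl⟩
      | @cons u v w h p ih =>
        intro hx
        obtain ⟨-, hv, -⟩ := (natGraph_adj I).1 (hadj h)
        obtain ⟨hy, hr⟩ := ih hv
        have huv : F₀.Adj ⟨u, hx⟩ ⟨v, hv⟩ := h
        exact ⟨hy, huv.reachable.trans hr⟩
    refine ⟨toSubgraph F₀ hF₀, fun q hq => ⟨trivial, trivial, ?_⟩, ?_⟩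
    · obtain ⟨p⟩ := hS _ (List.mem_map_of_mem hq)
      obtain ⟨hy, hr⟩ := key p q.1.2
      let f : F₀ →g (toSubgraph F₀ hF₀).coe := ⟨fun v => ⟨v, trivial⟩, fun h => h⟩
      exact hr.map f
    · refine le_trans ?_ hk
      have hinj : Function.Injective (Sym2.map (Fin.val : Fin I.n → ℕ)) :=
        Sym2.map.injective Fin.val_injective
      rw [← Set.ncard_image_of_injective _ hinj, ← Set.ncard_coe_finset]
      refine Set.ncard_le_ncard ?_ (Finset.finite_toSet E)
      rintro _ ⟨e, he, rfl⟩
      induction e with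
      | _ x y =>
        have hxy : F₀.Adj x y := he
        exact ((fromEdgeSet_adj _).1 (show (ofEdges E).Adj x y from hxy)).1

/-- The decision procedure is correct. -/
theorem solve_instance_iff (h : twoClaws.Free I.graph) :
    solve 168 (I.adjMatrixRows, natPairs I, I.k.bits, ()) = true ↔ I.IsYes := by
  rw [isYes_iff]
  refine solve_iff (adjB_adjMatrixRows I) (fun i j hij => ?_) (fun p hp => ?_)
    (clawsMeet_natGraph I h)
  · rw [length_adjMatrixRows]
    exact ((natGraph_adj I).1 hij).1
  · obtain ⟨q, -, rfl⟩ := List.mem_map.1 hp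
    rw [length_adjMatrixRows]
    exact ⟨q.1.2, q.2.2⟩

-- The final `()` is the `nil` that closes the list of three in `encode`, so no conversion of the
-- input is needed.
open WhileLang in
theorem enc_instance :
    Enc.enc (I.adjMatrixRows, natPairs I, I.k.bits, ()) = I.encode := by
  simp only [Enc.enc, SteinerInstance.encode, Val.ofList, Val.ofNatBinary, natPairs, List.map_map]
  rfl

end Instances

end SteinerForest

theorem lemma13 :
    WhileLang.PolyTimeSolvableOn SteinerInstance.encode
      (fun I : SteinerInstance => twoClaws.Free I.graph)
      (fun I : SteinerInstance => I.IsYes) := by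
  obtain ⟨⟨c, T, ⟨p, hp⟩, hc⟩, -⟩ := WhileLang.PF.solve 168
  refine ⟨c 0, p, fun I hI => ?_⟩
  -- With base register 0, input and answer are both in variable 0; `Computes` makes no demand on
  -- the other registers.
  obtain ⟨s, t, hrun, hs, -, ht⟩ := hc 0 (WhileLang.initStore I.encode) _
    (SteinerForest.enc_instance I).symm
  refine ⟨s, t, hrun, ht.trans ((hp _).trans_eq ?_), ?_⟩
  · rw [WhileLang.sz, SteinerForest.enc_instance]
  · refine Iff.trans ?_ (SteinerForest.solve_instance_iff I hI)
    rw [hs]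
    cases SteinerForest.solve 168 (I.adjMatrixRows, SteinerForest.natPairs I, I.k.bits, ()) <;>
      simp [WhileLang.Enc.enc, WhileLang.Val.ofBool]
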